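/- Let $A\in\mathbb R^{n\times n}$ and $b,c\in\mathbb R^n$ with $(A,b)$ controllable, let $\Omega\subset\mathbb R^n$ be compact and convex, $\theta\in\Omega$, $x_0\in\mathbb R^n$, and let $r:[0,\infty)\to\mathbb R$ be bounded and continuous. Let $K\in\mathbb R^n$ be such that $A_m=A-bK^\top$ is Hurwitz, put $H_o(s)=(sI-A_m)^{-1}b$, assume $c^\top H_o(0)\neq0$ and put $k_g=1/(c^\top H_o(0))$. Let $C(s)$ be a stable strictly proper rational transfer function with real coefficients and $C(0)=1$, let $Q$ be symmetric positive definite, let $P$ solve $A_m^\top P+PA_m=-Q$, let $\Gamma_c>0$ and $\hat\theta_0\in\Omega$. For $z\in\Omega$ and $y\in\mathbb R^n$ let $\mathrm{Proj}(z,y)$ be the Euclidean projection of $y$ onto the tangent cone of $\Omega$ at $z$. Consider a trajectory on $[0,\infty)$ of the uncertain system $$\dot x=Ax+b(u-\theta^\top x),\qquad x(0)=x_0,$$ with the $\mathcal L_1$ adaptive controller: the control $u=-K^\top x+u_2$, the state predictor $$\dot{\hat x}=A_m\hat x-b\,\hat\theta^\top x+b\,u_2,\qquad \hat x(0)=x_0,$$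 the adaptive law $$\dot{\hat\theta}=\Gamma_c\,\mathrm{Proj}\big(\hat\theta,\;x\,\tilde x^\top Pb\big),\qquad \hat\theta(0)=\hat\theta_0,\qquad \tilde x=\hat x-x$$ (in the sense of Carathéodory: $\hat\theta$ is locally absolutely continuous and the equation holds for almost every $t$), and the filtered signal $u_2(s)=C(s)\big(\bar r(s)+k_g r(s)\big)$ with $\bar r=\hat\theta^\top x$, that is, $u_2$ is the convolution on $[0,t]$ of the impulse response of $C$ with $\bar r+k_g r$. Let $\bar G(s)=H_o(s)\,(C(s)-1)$, let $\|\bar G\|_{\mathcal L_1}=\max_i\int_0^\infty|\bar g_i(t)|\,dt$, where $\bar g_i$ is the impulse response of the $i$-th entry of $\bar G$, and let $\theta_{\max}=\max_{z\in\Omega}\sum_{i=1}^n|z_i|$. If the $\mathcal L_1$-gain requirement $$\|\bar G\|_{\mathcal L_1}\,\theta_{\max}<1$$ holds, then $\hat x$ and $x$ are bounded on $[0,\infty)$ and $\lim_{t\to\infty}\tilde x(t)=0$. -/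

import Mathlib

open MeasureTheory

noncomputable section

namespace L1Adaptive

/-! ### Linear systems and transfer functions -/

/-- All eigenvalues of the real matrix `M` have negative real part. -/
def IsHurwitz {n : ℕ} (M : Matrix (Fin n) (Fin n) ℝ) : Prop :=
  ∀ z ∈ spectrum ℂ (M.map (algebraMap ℝ ℂ)), z.re < 0

/-- Kalman's criterion: `b, A b, …, A ^ (n - 1) b` span the state space. -/
def IsControllable {n : ℕ} (A : Matrix (Fin n) (Fin n) ℝ) (b : Fin n → ℝ) : Prop :=
  Submodule.span ℝ (Set.range fun k : Fin n => (A ^ (k : ℕ)).mulVec b) = ⊤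

/-- A rational transfer function is stable: all its poles lie in the open left half plane. -/
def IsStable (H : RatFunc ℝ) : Prop :=
  ∀ z : ℂ, H.denom.eval₂ (algebraMap ℝ ℂ) z = 0 → z.re < 0

/-- The denominator has larger degree than the numerator. -/
def IsStrictlyProper (H : RatFunc ℝ) : Prop :=
  H.num.degree < H.denom.degree

/-- `h` is the impulse response of the strictly proper transfer function `H`: it is continuous
on `[0, ∞)` and its Laplace transform is `H` on some right half plane. These conditions determine
`h` on `[0, ∞)`. -/
def IsImpulseResponse (h : ℝ → ℝ) (H : RatFunc ℝ) : Prop :=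
  ContinuousOn h (Set.Ici 0) ∧
    ∃ σ : ℝ, ∀ s : ℂ, σ < s.re →
      IntegrableOn (fun t : ℝ => Complex.exp (-(s * t)) * (h t : ℂ)) (Set.Ioi 0) ∧
      ∫ t in Set.Ioi (0 : ℝ), Complex.exp (-(s * t)) * (h t : ℂ) =
        H.eval (algebraMap ℝ ℂ) s

open Classical in
/-- The impulse response of a strictly proper transfer function (zero by convention if
there is none, which happens only for transfer functions that are not strictly proper). -/
def impulseResponse (H : RatFunc ℝ) : ℝ → ℝ :=
  if h : ∃ f : ℝ → ℝ, IsImpulseResponse f H then h.choose else 0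

/-- The zero-state response at time `t` of the strictly proper system `H` to the input `v`, that
is, the time-domain meaning of `y(s) = H(s) v(s)`. -/
def response (H : RatFunc ℝ) (v : ℝ → ℝ) (t : ℝ) : ℝ :=
  ∫ τ in (0 : ℝ)..t, impulseResponse H (t - τ) * v τ

/-- The `L₁` gain `max_i ∑_j ∫₀^∞ |h_ij(t)| dt` of a strictly proper system with `m` inputs and
`n` outputs. -/
def l1Gain {n m : ℕ} (H : Matrix (Fin n) (Fin m) (RatFunc ℝ)) : ENNReal :=
  ⨆ i, ∑ j, ∫⁻ t in Set.Ioi (0 : ℝ), ENNReal.ofReal |impulseResponse (H i j) t|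

/-- `H_o(s) = (s I - A_m)⁻¹ b`. -/
def Ho {n : ℕ} (Am : Matrix (Fin n) (Fin n) ℝ) (b : Fin n → ℝ) : Fin n → RatFunc ℝ :=
  (Matrix.scalar (Fin n) (RatFunc.X : RatFunc ℝ) - Am.map RatFunc.C)⁻¹.mulVec
    (fun i => RatFunc.C (b i))

/-- `Ḡ(s) = H_o(s) (C(s) - 1)`, a system with one input and `n` outputs. -/
def Gbar {n : ℕ} (Am : Matrix (Fin n) (Fin n) ℝ) (b : Fin n → ℝ) (C : RatFunc ℝ) :
    Matrix (Fin n) (Fin 1) (RatFunc ℝ) :=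
  Matrix.of fun i _ => Ho Am b i * (C - 1)

/-- The value `cᵀ H_o(0)`. -/
def dcGain {n : ℕ} (Am : Matrix (Fin n) (Fin n) ℝ) (b c : Fin n → ℝ) : ℝ :=
  (∑ i, RatFunc.C (c i) * Ho Am b i).eval (RingHom.id ℝ) 0

/-- `A_m = A - b Kᵀ`. -/
def closedMatrix {n : ℕ} (A : Matrix (Fin n) (Fin n) ℝ) (b K : Fin n → ℝ) :
    Matrix (Fin n) (Fin n) ℝ :=
  A - Matrix.vecMulVec b K

/-! ### Parameter set and projection -/

/-- `θ_max = max_{θ ∈ Ω} ∑ i, |θ_i|`. -/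
def thetaMax {n : ℕ} (Ω : Set (Fin n → ℝ)) : ℝ :=
  sSup ((fun z : Fin n → ℝ => ∑ i, |z i|) '' Ω)

/-- The tangent cone of the convex set `Ω` at `z`. -/
def tangentCone {n : ℕ} (Ω : Set (Fin n → ℝ)) (z : Fin n → ℝ) : Set (Fin n → ℝ) :=
  closure {v | ∃ s : ℝ, 0 ≤ s ∧ ∃ w ∈ Ω, v = s • (w - z)}

/-- `v = Proj(z, y)`: `v` is the Euclidean projection of the direction `y` onto the tangent cone
of `Ω` at `z`. Hence `Proj(z, y) = y` at interior points of `Ω`, and, at a point with a smooth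
boundary, `Proj(z, y)` is `y` without its outward normal component. -/
def IsProj {n : ℕ} (Ω : Set (Fin n → ℝ)) (z y v : Fin n → ℝ) : Prop :=
  v ∈ tangentCone Ω z ∧
    ∀ w ∈ tangentCone Ω z, ∑ i, (y i - v i) ^ 2 ≤ ∑ i, (y i - w i) ^ 2

/-! ### The closed loop -/

/-- The signals `x`, `xhat`, `θhat`, `u` form a trajectory on `[0, ∞)` of the uncertain system
with the `L₁` adaptive controller. The adaptive law has a discontinuous right-hand side and is
understood in the sense of Carathéodory, that is, in integrated form. -/
structure IsTrajectory {n : ℕ} (A : Matrix (Fin n) (Fin n) ℝ) (b c K : Fin n → ℝ)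
    (C : RatFunc ℝ) (P : Matrix (Fin n) (Fin n) ℝ) (Γc : ℝ) (Ω : Set (Fin n → ℝ))
    (θ : Fin n → ℝ) (r : ℝ → ℝ) (x₀ θhat₀ : Fin n → ℝ)
    (x xhat θhat : ℝ → Fin n → ℝ) (u u₁ u₂ : ℝ → ℝ) : Prop where
  /-- the plant -/
  x_zero : x 0 = x₀
  x_deriv : ∀ t, 0 ≤ t →
    HasDerivWithinAt x (A.mulVec (x t) + (u t - θ ⬝ᵥ x t) • b) (Set.Ici 0) t
  /-- the control signal -/
  control : ∀ t, 0 ≤ t → u t = u₁ t + u₂ t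
  control_one : ∀ t, 0 ≤ t → u₁ t = -(K ⬝ᵥ x t)
  control_two : ∀ t, 0 ≤ t →
    u₂ t = response C
      (fun τ => θhat τ ⬝ᵥ x τ + 1 / dcGain (closedMatrix A b K) b c * r τ) t
  /-- the state predictor -/
  xhat_zero : xhat 0 = x₀
  xhat_deriv : ∀ t, 0 ≤ t →
    HasDerivWithinAt xhat
      ((closedMatrix A b K).mulVec (xhat t) - (θhat t ⬝ᵥ x t) • b + u₂ t • b) (Set.Ici 0) t
  /-- the adaptive law -/
  θhat_law : ∃ v : ℝ → Fin n → ℝ,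
    (∀ T, 0 ≤ T → IntegrableOn v (Set.Icc 0 T)) ∧
    (∀ᵐ t ∂(volume.restrict (Set.Ici (0 : ℝ))),
      IsProj Ω (θhat t) (((xhat t - x t) ⬝ᵥ P.mulVec b) • x t) (v t)) ∧
    ∀ t, 0 ≤ t → θhat t = θhat₀ + Γc • ∫ τ in (0 : ℝ)..t, v τ

end L1Adaptive

end

/-! The filtered signal enters plant and predictor identically, so the error `e = x̂ - x` obeys `ė =
A_m e - ((θ̂ - θ)ᵀ x) b` whatever the filter does. Along a trajectory, `Γ eᵀPe + |θ̂ - θ|²`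
decreases at rate at least `Γ eᵀQe`: the projection inequality `IsProj.dotProduct_nonpos` lets the
parameter term absorb the indefinite cross term. Thus `e` is bounded and square integrable before
anything is known about the size of `x` (`lyapunov_estimate`). Symmetry and positivity of `P` are
derived from its equation, since `exp (t A_m)` decays.

Boundedness of the state comes from small gain. Variation of constants writes `x̂` as a decaying
free response, plus `ḡ * (θ̂ᵀx)`, plus a bounded response to the reference (`predictor_eq`). The
estimate `θ̂` stays in `Ω` (`mem_of_velocity_mem_tangentCone`) and `x = x̂ - e`, so `|θ̂ᵀx| ≤ θ_max
(‖x̂‖ + E)` with `E` a bound for `‖e‖`. The maximum of `‖x̂‖` over `[0, t]` is therefore at most `a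
+ q` times itself with `q < 1`, uniformly in `t` (`norm_le_of_small_gain`). Then `ė` is bounded, and
a square integrable signal with bounded derivative tends to zero.

The gain is defined through Laplace transforms of rational functions, so the kernel `ḡ` found in the
time domain must be identified with the impulse response of `Ḡ` (`isImpulseResponse_Gbar`). This
needs uniqueness of impulse responses, an integrable impulse response of `C`, and integrability of
`exp (t A_m) b`. The latter two are proved by induction over a multiset of roots in the left half
plane. -/

noncomputable section

namespace L1Adaptive

/-! ### Convolution and Laplace transform on the half line -/

/-- The convolution of two signals on `[0, t]`. -/
def conv {𝕜 : Type*} [RCLike 𝕜] (f g : ℝ → 𝕜) (t : ℝ) : 𝕜 :=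
  ∫ τ in (0 : ℝ)..t, f (t - τ) * g τ

/-- The Laplace transform of a signal on the half line. -/
def laplace (h : ℝ → ℂ) (s : ℂ) : ℂ :=
  ∫ t in Set.Ioi (0 : ℝ), Complex.exp (-(s * t)) * h t

lemma continuous_conv {𝕜 : Type*} [RCLike 𝕜] {f g : ℝ → 𝕜} (hf : Continuous f)
    (hg : Continuous g) : Continuous (conv f g) := by
  unfold conv
  refine intervalIntegral.continuous_parametric_intervalIntegral_of_continuous
    (f := fun t τ => f (t - τ) * g τ) ?_ continuous_id
  simp only [Function.uncurry_def]
  fun_prop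

lemma ofReal_conv (f g : ℝ → ℝ) (t : ℝ) :
    ((conv f g t : ℝ) : ℂ) = conv (fun τ => (f τ : ℂ)) (fun τ => (g τ : ℂ)) t := by
  unfold conv
  rw [← intervalIntegral.integral_ofReal]
  simp

lemma conv_congr_on {𝕜 : Type*} [RCLike 𝕜] {f f' g g' : ℝ → 𝕜}
    (hf : ∀ t, 0 ≤ t → f t = f' t) (hg : ∀ t, 0 ≤ t → g t = g' t) {t : ℝ} (ht : 0 ≤ t) :
    conv f g t = conv f' g' t := by
  unfold conv
  refine intervalIntegral.integral_congr fun τ hτ => ?_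
  rw [Set.uIcc_of_le ht] at hτ
  rw [hf _ (by linarith [hτ.2]), hg _ hτ.1]

lemma integrableOn_conv {𝕜 : Type*} [RCLike 𝕜] {f g : ℝ → 𝕜}
    (hf : IntegrableOn f (Set.Ioi 0)) (hg : IntegrableOn g (Set.Ioi 0)) :
    IntegrableOn (conv f g) (Set.Ioi 0) := by
  have h := integrable_posConvolution (μ := volume) (ν := volume) hg hf
    (ContinuousLinearMap.mul ℝ 𝕜)
  rw [posConvolution, integrable_indicator_iff measurableSet_Ioi] at h
  refine h.congr (Filter.Eventually.of_forall fun t => ?_)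
  simp [conv, mul_comm]

lemma laplace_conv {f g : ℝ → ℂ} {s : ℂ}
    (hf : IntegrableOn (fun t : ℝ => Complex.exp (-(s * t)) * f t) (Set.Ioi 0))
    (hg : IntegrableOn (fun t : ℝ => Complex.exp (-(s * t)) * g t) (Set.Ioi 0)) :
    laplace (conv f g) s = laplace f s * laplace g s := by
  have h := integral_posConvolution (μ := volume) (ν := volume) hg hf
    (ContinuousLinearMap.mul ℝ ℂ)
  simp only [ContinuousLinearMap.mul_apply'] at h
  rw [laplace, laplace, laplace, mul_comm (∫ t in Set.Ioi (0 : ℝ), Complex.exp (-(s * t)) * f t),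
    ← h]
  refine integral_congr_ae (Filter.Eventually.of_forall fun t => ?_)
  simp only [conv]
  rw [← intervalIntegral.integral_const_mul]
  refine intervalIntegral.integral_congr fun τ _ => ?_
  have : Complex.exp (-(s * t)) = Complex.exp (-(s * τ)) * Complex.exp (-(s * (t - τ : ℝ))) := by
    rw [← Complex.exp_add]
    push_cast
    ring_nf
  simp only [this]
  ring

lemma integrableOn_exp_mul {h : ℝ → ℂ} (hh : IntegrableOn h (Set.Ioi 0)) {s : ℂ} (hs : 0 ≤ s.re) :
    IntegrableOn (fun t : ℝ => Complex.exp (-(s * t)) * h t) (Set.Ioi 0) := by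
  refine Integrable.bdd_mul (c := 1) hh (by fun_prop) ?_
  refine (ae_restrict_iff' measurableSet_Ioi).2 (Filter.Eventually.of_forall fun t ht => ?_)
  rw [Complex.norm_exp]
  simp only [Complex.neg_re, Complex.mul_re, Complex.ofReal_re, Complex.ofReal_im, mul_zero,
    sub_zero, Real.exp_le_one_iff, Left.neg_nonpos_iff]
  exact mul_nonneg hs (le_of_lt ht)

lemma integrableOn_exp_neg {a : ℂ} (ha : a.re < 0) :
    IntegrableOn (fun t : ℝ => Complex.exp (a * t)) (Set.Ioi 0) := by
  exact integrableOn_exp_mul_complex_Ioi ha 0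

lemma laplace_exp {a s : ℂ} (ha : a.re < 0) (hs : 0 < s.re) :
    laplace (fun t : ℝ => Complex.exp (a * t)) s = 1 / (s - a) := by
  have h : (a - s).re < 0 := by simp; linarith
  have := integral_exp_mul_complex_Ioi h 0
  unfold laplace
  simp_rw [← Complex.exp_add]
  have e : ∀ t : ℝ, -(s * t) + a * t = (a - s) * t := fun t => by ring
  simp_rw [e, this]
  rw [← neg_sub s a, Complex.ofReal_zero, mul_zero, Complex.exp_zero, neg_div_neg_eq]

/-- A signal that is continuous on `[0, ∞)` is determined there by its Laplace transform. -/
lemma eqOn_zero_of_laplace_eq_zero {h : ℝ → ℂ} (hc : ContinuousOn h (Set.Ici 0)) {σ : ℝ}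
    (hi : ∀ s : ℂ, σ < s.re →
      IntegrableOn (fun t : ℝ => Complex.exp (-(s * t)) * h t) (Set.Ioi 0))
    (hl : ∀ s : ℂ, σ < s.re → laplace h s = 0) : ∀ t, 0 ≤ t → h t = 0 := by
  -- On the line `Re s = σ + 1` the Laplace transform of `h` is the Fourier transform of this damped
  -- signal. Fourier inversion then gives `h t = 0` at every `t > 0`; at `0`, where the truncated
  -- signal may jump, continuity from the right is used.
  set f : ℝ → ℂ := (Set.Ioi 0).indicator
    fun t : ℝ => Complex.exp (-(((σ + 1 : ℝ) : ℂ) * t)) * h t with hf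
  have hfi : Integrable f := by
    rw [hf, integrable_indicator_iff measurableSet_Ioi]
    exact hi _ (by simp)
  have hF : FourierTransform.fourier f = fun _ => (0 : ℂ) := by
    funext w
    rw [Real.fourier_real_eq_integral_exp_smul]
    have h1 := hl ((σ + 1 : ℝ) + (2 * Real.pi * w : ℝ) * Complex.I) (by simp)
    rw [laplace, ← integral_indicator measurableSet_Ioi] at h1
    rw [← h1]
    congr 1
    funext t
    by_cases ht : t ∈ Set.Ioi (0 : ℝ)
    · simp only [hf, Set.indicator_of_mem ht, smul_eq_mul]
      rw [← mul_assoc, ← Complex.exp_add]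
      congr 2
      push_cast
      ring
    · simp [hf, Set.indicator_of_notMem ht]
  have hpos : ∀ t, 0 < t → h t = 0 := by
    intro t ht
    have hca : ContinuousAt f t := by
      have h2 : ContinuousAt (fun t : ℝ => Complex.exp (-(((σ + 1 : ℝ) : ℂ) * t)) * h t) t := by
        refine ContinuousAt.mul (by fun_prop) (hc.continuousAt (Ici_mem_nhds ht))
      refine h2.congr ?_
      filter_upwards [Ioi_mem_nhds ht] with u hu
      simp only [hf, Set.indicator_of_mem hu]
    have h3 := hfi.fourierInv_fourier_eq (by rw [hF]; exact integrable_zero _ _ _) hca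
    rw [hF] at h3
    simp only [Real.fourierInv_eq, smul_zero, integral_zero, hf,
      Set.indicator_of_mem (Set.mem_Ioi.2 ht)] at h3
    simpa using h3.symm
  intro t ht
  rcases ht.eq_or_lt with rfl | ht
  · have h4 : Filter.Tendsto h (nhdsWithin 0 (Set.Ioi 0)) (nhds (h 0)) :=
      (hc 0 (by simp)).mono_left (nhdsWithin_mono _ Set.Ioi_subset_Ici_self)
    refine tendsto_nhds_unique h4 (tendsto_const_nhds.congr' ?_)
    filter_upwards [self_mem_nhdsWithin] with u hu
    exact (hpos u hu).symm
  · exact hpos t ht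

/-- This makes the choice in `impulseResponse` harmless: any explicit candidate may replace it on
`[0, ∞)`. -/
lemma IsImpulseResponse.eqOn {f g : ℝ → ℝ} {H : RatFunc ℝ} (hf : IsImpulseResponse f H)
    (hg : IsImpulseResponse g H) : ∀ t, 0 ≤ t → f t = g t := by
  obtain ⟨hfc, σ, hf⟩ := hf
  obtain ⟨hgc, σ', hg⟩ := hg
  intro t ht
  have key := eqOn_zero_of_laplace_eq_zero (h := fun t => (f t : ℂ) - (g t : ℂ)) (σ := max σ σ')
    ?_ ?_ ?_ t ht
  · have := sub_eq_zero.1 key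
    exact_mod_cast this
  · exact (Complex.continuous_ofReal.comp_continuousOn hfc).sub
      (Complex.continuous_ofReal.comp_continuousOn hgc)
  · intro s hs
    simp_rw [mul_sub]
    exact (hf s (lt_of_le_of_lt (le_max_left _ _) hs)).1.sub
      (hg s (lt_of_le_of_lt (le_max_right _ _) hs)).1
  · intro s hs
    have h1 := hf s (lt_of_le_of_lt (le_max_left _ _) hs)
    have h2 := hg s (lt_of_le_of_lt (le_max_right _ _) hs)
    simp_rw [laplace, mul_sub]
    rw [integral_sub h1.1 h2.1, h1.2, h2.2, sub_self]

lemma impulseResponse_eq {f : ℝ → ℝ} {H : RatFunc ℝ} (hf : IsImpulseResponse f H) {t : ℝ}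
    (ht : 0 ≤ t) : impulseResponse H t = f t := by
  have h : ∃ f : ℝ → ℝ, IsImpulseResponse f H := ⟨f, hf⟩
  rw [impulseResponse, dif_pos h]
  exact h.choose_spec.eqOn hf t ht

/-! ### Impulse responses of stable strictly proper transfer functions -/

/-- Induction on the poles. Convolution with `exp (a t)` adds a pole at `a` and preserves
integrability, which settles numerator `1`. For general `p`, division by `X - a` gives `p = (X - a)
p₁ + p(a)`: the first summand cancels the new pole and falls under the induction hypothesis, the
second is a multiple of the case just treated. Multiple poles need no separate discussion. -/
lemma exists_laplace_eq_div_prod (s : Multiset ℂ) (hs : ∀ a ∈ s, a.re < 0) (p : Polynomial ℂ)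
    (hp : p.degree < (Multiset.card s : ℕ)) :
    ∃ h : ℝ → ℂ, Continuous h ∧ IntegrableOn h (Set.Ioi 0) ∧
      ∀ z : ℂ, 0 < z.re → laplace h z = p.eval z / (s.map fun a => z - a).prod := by
  induction s using Multiset.induction_on generalizing p with
  | empty =>
    have hp0 : p = 0 := by
      rw [Multiset.card_zero] at hp
      exact Polynomial.degree_eq_bot.1 (Nat.WithBot.lt_zero_iff.1 hp)
    refine ⟨fun _ => 0, continuous_const, integrableOn_zero, fun z _ => ?_⟩
    simp [laplace, hp0]
  | cons a s ih =>
    have ha : a.re < 0 := hs a (Multiset.mem_cons_self a s)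
    have hs' : ∀ b ∈ s, b.re < 0 := fun b hb => hs b (Multiset.mem_cons_of_mem hb)
    have hne : ∀ z : ℂ, 0 < z.re → z - a ≠ 0 := fun z hz h => by
      rw [sub_eq_zero] at h
      rw [h] at hz
      linarith
    have hE : ∃ h : ℝ → ℂ, Continuous h ∧ IntegrableOn h (Set.Ioi 0) ∧
        ∀ z : ℂ, 0 < z.re → laplace h z = 1 / ((a ::ₘ s).map fun a => z - a).prod := by
      rcases Multiset.empty_or_exists_mem s with rfl | ⟨b, hb⟩
      · refine ⟨fun t : ℝ => Complex.exp (a * t), by fun_prop, integrableOn_exp_neg ha,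
          fun z hz => ?_⟩
        simp [laplace_exp ha hz]
      · obtain ⟨h, hc, hi, hl⟩ := ih hs' 1 (by
          rw [Polynomial.degree_one]
          exact_mod_cast Multiset.card_pos_iff_exists_mem.2 ⟨b, hb⟩)
        refine ⟨conv h (fun t : ℝ => Complex.exp (a * t)), continuous_conv hc (by fun_prop),
          integrableOn_conv hi (integrableOn_exp_neg ha), fun z hz => ?_⟩
        rw [laplace_conv (integrableOn_exp_mul hi hz.le)
          (integrableOn_exp_mul (integrableOn_exp_neg ha) hz.le), hl z hz, laplace_exp ha hz]
        simp [mul_comm]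
    obtain ⟨e, hec, hei, hel⟩ := hE
    set p₁ := p.divByMonic (Polynomial.X - Polynomial.C a) with hp₁
    have hpe : p = (Polynomial.X - Polynomial.C a) * p₁ + Polynomial.C (p.eval a) := by
      rw [← Polynomial.modByMonic_X_sub_C_eq_C_eval, add_comm]
      exact (Polynomial.modByMonic_add_div p (Polynomial.X - Polynomial.C a)).symm
    have hd : p₁.degree < (Multiset.card s : ℕ) := by
      by_cases h0 : p₁ = 0
      · rw [h0, Polynomial.degree_zero]
        exact WithBot.bot_lt_coe _
      · have hpn : p ≠ 0 := fun h => h0 (by rw [hp₁, h, Polynomial.zero_divByMonic])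
        rw [Polynomial.degree_eq_natDegree hpn, Multiset.card_cons] at hp
        rw [Polynomial.degree_eq_natDegree h0]
        have h2 : p₁.natDegree = p.natDegree - 1 := by
          rw [hp₁, Polynomial.natDegree_divByMonic _ (Polynomial.monic_X_sub_C a)]
          simp
        have h3 : p.natDegree < Multiset.card s + 1 := by exact_mod_cast hp
        -- The subtraction in `h2` truncates, so constant `p`, for which `p₁ = 0`, must be excluded.
        have h4 : p.natDegree ≠ 0 := fun h => h0 (by
          rw [hp₁, Polynomial.divByMonic_eq_zero_iff (Polynomial.monic_X_sub_C a),
            Polynomial.degree_eq_natDegree hpn, h]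
          simp)
        have : p₁.natDegree < Multiset.card s := by omega
        exact_mod_cast this
    obtain ⟨h, hc, hi, hl⟩ := ih hs' p₁ hd
    refine ⟨fun t => h t + p.eval a * e t, by fun_prop, hi.add (hei.const_mul _),
      fun z hz => ?_⟩
    have h1 := hl z hz
    have h2 := hel z hz
    have h3 : p.eval z = (z - a) * p₁.eval z + p.eval a := by
      conv_lhs => rw [hpe]
      simp
    have hsplit : laplace (fun t => h t + p.eval a * e t) z
        = laplace h z + p.eval a * laplace e z := by
      unfold laplace
      rw [← integral_const_mul, ← integral_add (integrableOn_exp_mul hi hz.le)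
        ((integrableOn_exp_mul hei hz.le).const_mul _)]
      refine integral_congr_ae (Filter.Eventually.of_forall fun t => ?_)
      simp only
      ring
    rw [hsplit, h1, h2, h3, Multiset.map_cons, Multiset.prod_cons, add_div,
      mul_div_mul_left _ _ (hne z hz), mul_one_div]

lemma laplace_conj (h : ℝ → ℂ) (z : ℂ) :
    laplace (fun t => (starRingEnd ℂ) (h t)) z
      = (starRingEnd ℂ) (laplace h ((starRingEnd ℂ) z)) := by
  unfold laplace
  rw [← integral_conj]
  simp [← Complex.exp_conj]

lemma eval_conj (H : RatFunc ℝ) (z : ℂ) :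
    (starRingEnd ℂ) (H.eval (algebraMap ℝ ℂ) ((starRingEnd ℂ) z))
      = H.eval (algebraMap ℝ ℂ) z := by
  have h : ∀ p : Polynomial ℝ, (starRingEnd ℂ) (p.eval₂ (algebraMap ℝ ℂ) ((starRingEnd ℂ) z))
      = p.eval₂ (algebraMap ℝ ℂ) z := by
    intro p
    rw [Polynomial.hom_eval₂]
    simp only [Complex.conj_conj]
    congr 1
    ext x
    simp
  simp [RatFunc.eval, h]

/-- A stable strictly proper transfer function has a continuous absolutely integrable impulse
response. -/
lemma exists_impulseResponse {C : RatFunc ℝ} (hC_stable : IsStable C)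
    (hC_proper : IsStrictlyProper C) :
    ∃ f : ℝ → ℝ, Continuous f ∧ IntegrableOn f (Set.Ioi 0) ∧
      ∀ z : ℂ, 0 < z.re → laplace (fun t => (f t : ℂ)) z = C.eval (algebraMap ℝ ℂ) z := by
  set q : Polynomial ℂ := C.denom.map (algebraMap ℝ ℂ) with hq
  set p : Polynomial ℂ := C.num.map (algebraMap ℝ ℂ) with hp
  have hqm : q.Monic := (RatFunc.monic_denom C).map _
  have hsplit : q.Splits := IsAlgClosed.splits q
  have hroots : q = (q.roots.map fun a => Polynomial.X - Polynomial.C a).prod :=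
    hsplit.eq_prod_roots_of_monic hqm
  have hcard : Multiset.card q.roots = q.natDegree := hsplit.natDegree_eq_card_roots.symm
  obtain ⟨h, hc, hi, hl⟩ := exists_laplace_eq_div_prod q.roots (fun a ha => by
      apply hC_stable a
      have := (Polynomial.mem_roots hqm.ne_zero).1 ha
      rwa [Polynomial.IsRoot.def, hq, Polynomial.eval_map] at this) p (by
      rw [hcard, ← Polynomial.degree_eq_natDegree hqm.ne_zero, hp, hq, Polynomial.degree_map,
        Polynomial.degree_map]
      exact hC_proper)
  have hl' : ∀ z : ℂ, 0 < z.re → laplace h z = C.eval (algebraMap ℝ ℂ) z := by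
    intro z hz
    rw [hl z hz, RatFunc.eval, ← Polynomial.eval_map, ← Polynomial.eval_map, ← hp, ← hq]
    congr 1
    conv_rhs => rw [hroots]
    rw [Polynomial.eval_multiset_prod, Multiset.map_map]
    simp
  -- The complex signal `h` and its conjugate have the same transform because `C` has real
  -- coefficients, so their average, the real part, has it too.
  refine ⟨fun t => (h t).re, by fun_prop, hi.re, fun z hz => ?_⟩
  have hre : ∀ t, (((h t).re : ℝ) : ℂ) = (1 / 2) * h t + (1 / 2) * (starRingEnd ℂ) (h t) := by
    intro t
    rw [Complex.re_eq_add_conj]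
    ring
  have hi' : IntegrableOn (fun t => (starRingEnd ℂ) (h t)) (Set.Ioi 0) :=
    Complex.conjCLE.toContinuousLinearMap.integrable_comp hi
  have hz' : 0 < ((starRingEnd ℂ) z).re := by simpa using hz
  have : laplace (fun t => (((h t).re : ℝ) : ℂ)) z
      = (1 / 2) * laplace h z + (1 / 2) * laplace (fun t => (starRingEnd ℂ) (h t)) z := by
    unfold laplace
    rw [← integral_const_mul, ← integral_const_mul,
      ← integral_add ((integrableOn_exp_mul hi hz.le).const_mul _)
        ((integrableOn_exp_mul hi' hz.le).const_mul _)]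
    refine integral_congr_ae (Filter.Eventually.of_forall fun t => ?_)
    simp only [hre]
    ring
  rw [this, laplace_conj, hl' z hz, hl' _ hz', eval_conj]
  ring

lemma isImpulseResponse_of_laplace {f : ℝ → ℝ} {H : RatFunc ℝ} (hc : Continuous f)
    (hi : IntegrableOn f (Set.Ioi 0))
    (hl : ∀ z : ℂ, 0 < z.re → laplace (fun t => (f t : ℂ)) z = H.eval (algebraMap ℝ ℂ) z) :
    IsImpulseResponse f H :=
  ⟨hc.continuousOn, 0, fun z hz => ⟨integrableOn_exp_mul hi.ofReal hz.le, hl z hz⟩⟩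

/-! ### The matrix exponential of a Hurwitz matrix -/

section MatrixExp

attribute [local instance] Matrix.linftyOpNormedRing Matrix.linftyOpNormedAlgebra

lemma hasDerivAt_exp_apply {n : ℕ} (A : Matrix (Fin n) (Fin n) ℝ) (i j : Fin n) (t : ℝ) :
    HasDerivAt (fun u : ℝ => NormedSpace.exp (u • A) i j)
      ((NormedSpace.exp (t • A) * A) i j) t := by
  have h := hasDerivAt_exp_smul_const (𝕂 := ℝ) A t
  exact (Matrix.entryLinearMap ℝ ℝ i j).toContinuousLinearMap.hasFDerivAt.comp_hasDerivAt t h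

lemma exp_smul_mul_comm {n : ℕ} (A : Matrix (Fin n) (Fin n) ℝ) (t : ℝ) :
    NormedSpace.exp (t • A) * A = A * NormedSpace.exp (t • A) :=
  (((Commute.refl A).smul_left t).exp_left).eq

end MatrixExp

/-- The solution `exp (t A) x` of `ẏ = A y`, `y(0) = x`. -/
def expVec {n : ℕ} (A : Matrix (Fin n) (Fin n) ℝ) (x : Fin n → ℝ) (t : ℝ) : Fin n → ℝ :=
  (NormedSpace.exp (t • A)).mulVec x

lemma expVec_zero {n : ℕ} (A : Matrix (Fin n) (Fin n) ℝ) (x : Fin n → ℝ) :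
    expVec A x 0 = x := by
  simp [expVec]

lemma hasDerivAt_expVec_apply {n : ℕ} (A : Matrix (Fin n) (Fin n) ℝ) (x : Fin n → ℝ) (t : ℝ)
    (i : Fin n) :
    HasDerivAt (fun u => expVec A x u i) (A.mulVec (expVec A x t) i) t := by
  have h : HasDerivAt (fun u => ∑ j, NormedSpace.exp (u • A) i j * x j)
      (∑ j, (NormedSpace.exp (t • A) * A) i j * x j) t :=
    HasDerivAt.fun_sum fun j _ => (hasDerivAt_exp_apply A i j t).mul_const (x j)
  rw [exp_smul_mul_comm] at h
  rw [expVec, Matrix.mulVec_mulVec]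
  exact h

lemma continuous_expVec_apply {n : ℕ} (A : Matrix (Fin n) (Fin n) ℝ) (x : Fin n → ℝ)
    (i : Fin n) : Continuous fun t => expVec A x t i :=
  continuous_iff_continuousAt.2 fun t => (hasDerivAt_expVec_apply A x t i).continuousAt

/-- By variation of constants, `y` is a decaying exponential plus a convolution of two integrable
functions. -/
lemma integrableOn_of_hasDerivAt {y g : ℝ → ℂ} {a : ℂ} (ha : a.re < 0)
    (hy : ∀ t, HasDerivAt y (a * y t + g t) t) (hg : Continuous g)
    (hgi : IntegrableOn g (Set.Ioi 0)) : IntegrableOn y (Set.Ioi 0) := by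
  have h : ∀ t, y t = Complex.exp (a * t) * y 0 + conv (fun t : ℝ => Complex.exp (a * t)) g t := by
    intro t
    have hd : ∀ τ : ℝ, HasDerivAt (fun τ : ℝ => Complex.exp (a * (t - τ : ℝ)) * y τ)
        (Complex.exp (a * (t - τ : ℝ)) * g τ) τ := by
      intro τ
      have h1 : HasDerivAt (fun τ : ℝ => Complex.exp (a * (t - τ : ℝ)))
          (Complex.exp (a * (t - τ : ℝ)) * (a * (-1))) τ := by
        refine HasDerivAt.cexp (HasDerivAt.const_mul a ?_)
        simpa using ((hasDerivAt_id τ).const_sub t).ofReal_comp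
      convert! h1.mul (hy τ) using 1
      ring
    have h2 := intervalIntegral.integral_eq_sub_of_hasDerivAt (a := 0) (b := t)
      (fun τ _ => hd τ) ((by fun_prop : Continuous fun τ : ℝ =>
        Complex.exp (a * (t - τ : ℝ)) * g τ).intervalIntegrable _ _)
    simp only [conv]
    rw [h2]
    simp
  rw [show y = fun t : ℝ => Complex.exp (a * t) * y 0 + conv (fun t : ℝ => Complex.exp (a * t)) g t
    from funext h]
  exact ((integrableOn_exp_neg ha).mul_const _).add (integrableOn_conv (integrableOn_exp_neg ha) hgi)

lemma hasDerivAt_mulVec {n : ℕ} (N : Matrix (Fin n) (Fin n) ℂ) {Y : ℝ → Fin n → ℂ}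
    {Y' : Fin n → ℂ} {t : ℝ} (hY : HasDerivAt Y Y' t) :
    HasDerivAt (fun u => N.mulVec (Y u)) (N.mulVec Y') t :=
  (N.mulVecLin.restrictScalars ℝ).toContinuousLinearMap.hasFDerivAt.comp_hasDerivAt t hY

/-- Factors are peeled off one at a time. With `N = M - a`, the curve `N Y` solves the same equation
and is annihilated by the remaining product, so it is integrable by induction; each component of `Y`
then solves `ẏ = a y + (N Y)_i`. Cayley–Hamilton supplies the annihilating product, and no Jordan
form is needed. -/
lemma integrableOn_of_prod_mulVec_eq_zero {n : ℕ} (M : Matrix (Fin n) (Fin n) ℂ)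
    (s : Multiset ℂ) (hs : ∀ a ∈ s, a.re < 0) (Y : ℝ → Fin n → ℂ)
    (hY : ∀ t, HasDerivAt Y (M.mulVec (Y t)) t)
    (h0 : ∀ t, (Polynomial.aeval M
      (s.map fun a => Polynomial.X - Polynomial.C a).prod).mulVec (Y t) = 0) :
    IntegrableOn Y (Set.Ioi 0) := by
  induction s using Multiset.induction_on generalizing Y with
  | empty =>
    have : Y = fun _ => 0 := funext fun t => by simpa using h0 t
    rw [this]
    exact integrableOn_zero
  | cons a s ih =>
    have ha : a.re < 0 := hs a (Multiset.mem_cons_self a s)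
    set N : Matrix (Fin n) (Fin n) ℂ := M - Matrix.scalar (Fin n) a with hN
    have hNM : N * M = M * N := by
      rw [hN, sub_mul, mul_sub, (Matrix.scalar_commute a (Commute.all a) M).eq]
    have hZ : ∀ t, HasDerivAt (fun t => N.mulVec (Y t)) (M.mulVec (N.mulVec (Y t))) t := by
      intro t
      rw [Matrix.mulVec_mulVec, ← hNM, ← Matrix.mulVec_mulVec]
      exact hasDerivAt_mulVec N (hY t)
    have hZi := ih (fun b hb => hs b (Multiset.mem_cons_of_mem hb)) _ hZ (fun t => by
      have := h0 t
      rw [Multiset.map_cons, Multiset.prod_cons, mul_comm, map_mul, ← Matrix.mulVec_mulVec] at this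
      rwa [show Polynomial.aeval M (Polynomial.X - Polynomial.C a) = N by
        rw [map_sub, Polynomial.aeval_X, Polynomial.aeval_C]
        rfl] at this)
    have hcomp : ∀ i, IntegrableOn (fun t => Y t i) (Set.Ioi 0) := by
      intro i
      refine integrableOn_of_hasDerivAt (g := fun t => N.mulVec (Y t) i) ha (fun t => ?_) ?_ ?_
      · have h1 := (hasDerivAt_pi.1 (hY t)) i
        convert! h1 using 1
        simp [hN, Matrix.sub_mulVec]
      · exact (continuous_apply i).comp
          (continuous_iff_continuousAt.2 fun t => (hZ t).continuousAt)
      · exact (ContinuousLinearMap.proj (R := ℝ) (φ := fun _ : Fin n => ℂ) i).integrable_comp hZi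
    exact Integrable.of_eval hcomp

lemma integrableOn_expVec_apply {n : ℕ} {A : Matrix (Fin n) (Fin n) ℝ} (hA : IsHurwitz A)
    (x : Fin n → ℝ) (i : Fin n) : IntegrableOn (fun t => expVec A x t i) (Set.Ioi 0) := by
  set M : Matrix (Fin n) (Fin n) ℂ := A.map (algebraMap ℝ ℂ) with hM
  have hY : ∀ t, HasDerivAt (fun t => fun i => (expVec A x t i : ℂ))
      (M.mulVec fun i => (expVec A x t i : ℂ)) t := by
    intro t
    rw [hasDerivAt_pi]
    intro i
    convert! (hasDerivAt_expVec_apply A x t i).ofReal_comp using 1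
    simp [hM, Matrix.mulVec, dotProduct]
  have hroots : M.charpoly = (M.charpoly.roots.map fun a => Polynomial.X - Polynomial.C a).prod :=
    (IsAlgClosed.splits M.charpoly).eq_prod_roots_of_monic M.charpoly_monic
  have h := integrableOn_of_prod_mulVec_eq_zero M M.charpoly.roots (fun a ha => by
      apply hA a
      rw [Matrix.mem_spectrum_iff_isRoot_charpoly]
      exact (Polynomial.mem_roots M.charpoly_monic.ne_zero).1 ha) _ hY (fun t => by
      rw [← hroots, Matrix.aeval_self_charpoly, Matrix.zero_mulVec])
  have h1 := (ContinuousLinearMap.proj (R := ℝ) (φ := fun _ : Fin n => ℂ) i).integrable_comp h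
  exact h1.re

lemma tendsto_expVec_apply {n : ℕ} {A : Matrix (Fin n) (Fin n) ℝ} (hA : IsHurwitz A)
    (x : Fin n → ℝ) (i : Fin n) :
    Filter.Tendsto (fun t => expVec A x t i) Filter.atTop (nhds 0) := by
  refine tendsto_zero_of_hasDerivAt_of_integrableOn_Ioi (a := 0)
    (fun t _ => hasDerivAt_expVec_apply A x t i) ?_ (integrableOn_expVec_apply hA x i)
  simp only [Matrix.mulVec, dotProduct]
  exact integrable_finsetSum _ fun j _ => (integrableOn_expVec_apply hA x j).const_mul _

lemma exists_bound_expVec_apply {n : ℕ} {A : Matrix (Fin n) (Fin n) ℝ} (hA : IsHurwitz A)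
    (x : Fin n → ℝ) (i : Fin n) : ∃ M, ∀ t, 0 ≤ t → |expVec A x t i| ≤ M := by
  have h1 := (tendsto_expVec_apply hA x i).abs
  rw [abs_zero] at h1
  obtain ⟨T, hT⟩ := Filter.eventually_atTop.1 (h1.eventually (gt_mem_nhds one_pos))
  obtain ⟨B, hB⟩ := (isCompact_Icc (a := (0 : ℝ)) (b := T)).exists_bound_of_continuousOn
    (continuous_expVec_apply A x i).continuousOn
  refine ⟨max B 1, fun t ht => ?_⟩
  rcases le_total t T with h | h
  · exact (hB t ⟨ht, h⟩).trans (le_max_left _ _)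
  · exact (hT t h).le.trans (le_max_right _ _)

/-- The Laplace transform of `exp (t A) b` solves `(z I - A) L = b`. -/
lemma laplace_expVec {n : ℕ} {A : Matrix (Fin n) (Fin n) ℝ} (hA : IsHurwitz A)
    (b : Fin n → ℝ) {z : ℂ} (hz : 0 < z.re) :
    (Matrix.scalar (Fin n) z - A.map (algebraMap ℝ ℂ)).mulVec
      (fun i => laplace (fun t => (expVec A b t i : ℂ)) z) = fun i => (b i : ℂ) := by
  funext i
  have hint : ∀ j, IntegrableOn
      (fun t : ℝ => Complex.exp (-(z * t)) * (expVec A b t j : ℂ)) (Set.Ioi 0) :=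
    fun j => integrableOn_exp_mul (integrableOn_expVec_apply hA b j).ofReal hz.le
  -- Integrating this derivative over the half line leaves minus the initial value, `-b i`, which is
  -- the transformed equation.
  have hd : ∀ t : ℝ, HasDerivAt (fun t : ℝ => Complex.exp (-(z * t)) * (expVec A b t i : ℂ))
      (∑ j, (A i j : ℂ) * (Complex.exp (-(z * t)) * (expVec A b t j : ℂ))
        - z * (Complex.exp (-(z * t)) * (expVec A b t i : ℂ))) t := by
    intro t
    have h1 : HasDerivAt (fun τ : ℝ => Complex.exp (-(z * τ)))
        (Complex.exp (-(z * t)) * (-(z * 1))) t := by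
      refine HasDerivAt.cexp (HasDerivAt.neg (HasDerivAt.const_mul z ?_))
      simpa using (hasDerivAt_id t).ofReal_comp
    convert! h1.mul (hasDerivAt_expVec_apply A b t i).ofReal_comp using 1
    simp only [Matrix.mulVec, dotProduct, Complex.ofReal_sum, Complex.ofReal_mul]
    rw [Finset.mul_sum, sub_eq_neg_add]
    congr 1
    · ring
    · exact Finset.sum_congr rfl fun j _ => by ring
  have hdi : IntegrableOn (fun t : ℝ =>
      ∑ j, (A i j : ℂ) * (Complex.exp (-(z * t)) * (expVec A b t j : ℂ))
        - z * (Complex.exp (-(z * t)) * (expVec A b t i : ℂ))) (Set.Ioi 0) :=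
    (integrable_finsetSum _ fun j _ => (hint j).const_mul _).sub ((hint i).const_mul _)
  have hlim := tendsto_zero_of_hasDerivAt_of_integrableOn_Ioi (a := 0) (fun t _ => hd t) hdi
    (hint i)
  have h := integral_Ioi_of_hasDerivAt_of_tendsto' (a := 0) (fun t _ => hd t) hdi hlim
  rw [integral_sub (integrable_finsetSum _ fun j _ => (hint j).const_mul _)
    ((hint i).const_mul _), integral_finsetSum _ fun j _ => (hint j).const_mul _] at h
  simp only [integral_const_mul, expVec_zero] at h
  rw [Matrix.sub_mulVec]
  simp only [Pi.sub_apply, Matrix.scalar_apply, Matrix.mulVec_diagonal]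
  simp only [Matrix.mulVec, dotProduct, Matrix.map_apply, laplace, Complex.coe_algebraMap]
  simp only [Complex.ofReal_zero, mul_zero, neg_zero, Complex.exp_zero, one_mul, zero_sub] at h
  linear_combination -h

/-! ### The impulse response of `Ḡ` -/

lemma charpoly_eval_ne_zero {n : ℕ} {A : Matrix (Fin n) (Fin n) ℝ} (hA : IsHurwitz A) {z : ℂ}
    (hz : 0 < z.re) : A.charpoly.eval₂ (algebraMap ℝ ℂ) z ≠ 0 := by
  intro h
  rw [← Polynomial.eval_map, ← Matrix.charpoly_map] at h
  have := hA z (Matrix.mem_spectrum_iff_isRoot_charpoly.2 h)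
  linarith

/-- The numerator of `H_o` over the characteristic polynomial. -/
def HoNum {n : ℕ} (A : Matrix (Fin n) (Fin n) ℝ) (b : Fin n → ℝ) (i : Fin n) : Polynomial ℝ :=
  (A.charmatrix.adjugate.mulVec fun j => Polynomial.C (b j)) i

/-- Cramer's rule reduces the inverse over rational functions to polynomials, which can be evaluated
at complex points. -/
lemma Ho_eq_div {n : ℕ} (A : Matrix (Fin n) (Fin n) ℝ) (b : Fin n → ℝ) (i : Fin n) :
    Ho A b i = algebraMap (Polynomial ℝ) (RatFunc ℝ) (HoNum A b i)
      / algebraMap (Polynomial ℝ) (RatFunc ℝ) A.charpoly := by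
  set φ := algebraMap (Polynomial ℝ) (RatFunc ℝ) with hφ
  have hR : Matrix.scalar (Fin n) (RatFunc.X : RatFunc ℝ) - A.map RatFunc.C
      = φ.mapMatrix A.charmatrix := by
    ext i j
    by_cases h : i = j
    · subst h
      simp [hφ, Matrix.charmatrix_apply_eq, RatFunc.algebraMap_X, RatFunc.algebraMap_C]
    · simp [hφ, h, RatFunc.algebraMap_C]
  rw [Ho, hR, Matrix.inv_def, ← RingHom.map_det, ← RingHom.map_adjugate, Ring.inverse_eq_inv',
    Matrix.smul_mulVec, Pi.smul_apply, smul_eq_mul, mul_comm, div_eq_mul_inv]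
  congr 1
  simp [HoNum, Matrix.mulVec, dotProduct, hφ, RatFunc.algebraMap_C]

/-- `RatFunc.eval_mul` requires nonvanishing denominators; here the denominator divides the
characteristic polynomial. -/
lemma denom_Ho_eval_ne_zero {n : ℕ} {A : Matrix (Fin n) (Fin n) ℝ} (hA : IsHurwitz A)
    (b : Fin n → ℝ) (i : Fin n) {z : ℂ} (hz : 0 < z.re) :
    (Ho A b i).denom.eval₂ (algebraMap ℝ ℂ) z ≠ 0 := by
  rw [Ho_eq_div]
  intro h
  exact charpoly_eval_ne_zero hA hz
    (Polynomial.eval₂_eq_zero_of_dvd_of_eval₂_eq_zero _ _ (RatFunc.denom_div_dvd _ _) h)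

lemma Ho_eval_mul_charpoly {n : ℕ} {A : Matrix (Fin n) (Fin n) ℝ} (hA : IsHurwitz A)
    (b : Fin n → ℝ) (i : Fin n) {z : ℂ} (hz : 0 < z.re) :
    (Ho A b i).eval (algebraMap ℝ ℂ) z * A.charpoly.eval₂ (algebraMap ℝ ℂ) z
      = (HoNum A b i).eval₂ (algebraMap ℝ ℂ) z := by
  have hne : algebraMap (Polynomial ℝ) (RatFunc ℝ) A.charpoly ≠ 0 := by
    simpa using A.charpoly_monic.ne_zero
  have h : Ho A b i * algebraMap (Polynomial ℝ) (RatFunc ℝ) A.charpoly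
      = algebraMap (Polynomial ℝ) (RatFunc ℝ) (HoNum A b i) := by
    rw [Ho_eq_div, div_mul_cancel₀ _ hne]
  have h1 := congrArg (RatFunc.eval (algebraMap ℝ ℂ) z) h
  rw [RatFunc.eval_mul _ _ (denom_Ho_eval_ne_zero hA b i hz) (by simp [RatFunc.denom_algebraMap]),
    RatFunc.eval_algebraMap, RatFunc.eval_algebraMap] at h1
  exact h1

/-- Applying the evaluated adjugate to `laplace_expVec` shows that the transform times the
characteristic polynomial at `z` is the numerator of `H_o`; that factor is nonzero and cancels. -/
lemma laplace_expVec_apply {n : ℕ} {A : Matrix (Fin n) (Fin n) ℝ} (hA : IsHurwitz A)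
    (b : Fin n → ℝ) (i : Fin n) {z : ℂ} (hz : 0 < z.re) :
    laplace (fun t => (expVec A b t i : ℂ)) z = (Ho A b i).eval (algebraMap ℝ ℂ) z := by
  refine mul_right_cancel₀ (charpoly_eval_ne_zero hA hz) ?_
  rw [Ho_eval_mul_charpoly hA b i hz]
  set ψ := Polynomial.eval₂RingHom (algebraMap ℝ ℂ) z with hψ
  have hR : Matrix.scalar (Fin n) z - A.map (algebraMap ℝ ℂ) = ψ.mapMatrix A.charmatrix := by
    ext i j
    by_cases h : i = j
    · subst h
      simp [hψ, Matrix.charmatrix_apply_eq]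
    · simp [hψ, h]
  have h := congrArg (fun v => (ψ.mapMatrix A.charmatrix.adjugate).mulVec v i)
    (laplace_expVec hA b hz)
  simp only [hR, Matrix.mulVec_mulVec] at h
  rw [← map_mul, Matrix.adjugate_mul] at h
  have e1 : ψ.mapMatrix (A.charmatrix.det • (1 : Matrix (Fin n) (Fin n) (Polynomial ℝ)))
      = Matrix.scalar (Fin n) (A.charpoly.eval₂ (algebraMap ℝ ℂ) z) := by
    ext i j
    by_cases h : i = j
    · subst h
      simp [hψ, Matrix.charpoly]
    · simp [h]
  rw [e1, Matrix.scalar_apply, Matrix.mulVec_diagonal, mul_comm] at h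
  rw [h, HoNum]
  simp only [Matrix.mulVec, dotProduct, RingHom.mapMatrix_apply, Matrix.map_apply]
  change _ = ψ _
  rw [map_sum]
  simp [hψ]

lemma isImpulseResponse_Gbar {n : ℕ} {A : Matrix (Fin n) (Fin n) ℝ} (hA : IsHurwitz A)
    (b : Fin n → ℝ) {C : RatFunc ℝ} (hC : IsStable C) {f : ℝ → ℝ} (hfc : Continuous f)
    (hfi : IntegrableOn f (Set.Ioi 0))
    (hfl : ∀ z : ℂ, 0 < z.re → laplace (fun t => (f t : ℂ)) z = C.eval (algebraMap ℝ ℂ) z)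
    (i : Fin n) :
    IsImpulseResponse (fun t => conv (fun t => expVec A b t i) f t - expVec A b t i)
      (Gbar A b C i 0) := by
  have hi := integrableOn_expVec_apply hA b i
  have hc := continuous_expVec_apply A b i
  refine isImpulseResponse_of_laplace ((continuous_conv hc hfc).sub hc)
    ((integrableOn_conv hi hfi).sub hi) fun z hz => ?_
  have hdC : C.denom.eval₂ (algebraMap ℝ ℂ) z ≠ 0 := fun h => by linarith [hC z h]
  have hC1 : C - 1 = C + RatFunc.C (-1) := by simp [sub_eq_add_neg]
  have hd1 : (C - 1).denom.eval₂ (algebraMap ℝ ℂ) z ≠ 0 := by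
    intro h
    refine hdC (Polynomial.eval₂_eq_zero_of_dvd_of_eval₂_eq_zero _ _ (p := (C - 1).denom) ?_ h)
    rw [hC1]
    have := RatFunc.denom_add_dvd C (RatFunc.C (-1))
    rwa [RatFunc.denom_C, mul_one] at this
  have hev : (Gbar A b C i 0).eval (algebraMap ℝ ℂ) z
      = (Ho A b i).eval (algebraMap ℝ ℂ) z * (C.eval (algebraMap ℝ ℂ) z - 1) := by
    rw [Gbar, Matrix.of_apply, RatFunc.eval_mul _ _ (denom_Ho_eval_ne_zero hA b i hz) hd1, hC1,
      RatFunc.eval_add _ _ hdC (by rw [RatFunc.denom_C]; simp), RatFunc.eval_C]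
    simp [sub_eq_add_neg]
  have hL := laplace_expVec_apply hA b i hz
  have hi' : IntegrableOn (fun t => (expVec A b t i : ℂ)) (Set.Ioi 0) := hi.ofReal
  have hfi' : IntegrableOn (fun t => (f t : ℂ)) (Set.Ioi 0) := hfi.ofReal
  rw [hev, ← hL, ← hfl z hz, mul_sub, mul_one, ← laplace_conv
    (integrableOn_exp_mul hi' hz.le) (integrableOn_exp_mul hfi' hz.le)]
  simp only [laplace, Complex.ofReal_sub, ofReal_conv, mul_sub]
  exact integral_sub (integrableOn_exp_mul (integrableOn_conv hi' hfi') hz.le)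
    (integrableOn_exp_mul hi' hz.le)

/-! ### The Lyapunov equation -/

lemma mulVec_dotProduct {n : ℕ} (A : Matrix (Fin n) (Fin n) ℝ) (x w : Fin n → ℝ) :
    A.mulVec x ⬝ᵥ w = x ⬝ᵥ A.transpose.mulVec w := by
  rw [Matrix.mulVec_transpose, dotProduct_comm, Matrix.dotProduct_mulVec, dotProduct_comm]

lemma hasDerivWithinAt_dotProduct_mulVec {n : ℕ} (P : Matrix (Fin n) (Fin n) ℝ)
    {y w : ℝ → Fin n → ℝ} {y' w' : Fin n → ℝ} {s : Set ℝ} {t : ℝ}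
    (hy : HasDerivWithinAt y y' s t) (hw : HasDerivWithinAt w w' s t) :
    HasDerivWithinAt (fun u => y u ⬝ᵥ P.mulVec (w u))
      (y' ⬝ᵥ P.mulVec (w t) + y t ⬝ᵥ P.mulVec w') s t := by
  rw [hasDerivWithinAt_pi] at hy hw
  have h : HasDerivWithinAt (fun u => ∑ i, y u i * ∑ j, P i j * w u j)
      (∑ i, (y' i * (∑ j, P i j * w t j) + y t i * ∑ j, P i j * w' j)) s t :=
    HasDerivWithinAt.fun_sum fun i _ => (hy i).mul
      (HasDerivWithinAt.fun_sum fun j _ => (hw j).const_mul (P i j))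
  rw [Finset.sum_add_distrib] at h
  exact h

lemma hasDerivAt_expVec_dotProduct {n : ℕ} {A P Q : Matrix (Fin n) (Fin n) ℝ}
    (hP : A.transpose * P + P * A = -Q) (x y : Fin n → ℝ) (t : ℝ) :
    HasDerivAt (fun u => expVec A x u ⬝ᵥ P.mulVec (expVec A y u))
      (-(expVec A x t ⬝ᵥ Q.mulVec (expVec A y t))) t := by
  have hx : HasDerivAt (expVec A x) (A.mulVec (expVec A x t)) t :=
    hasDerivAt_pi.2 (hasDerivAt_expVec_apply A x t)
  have hy : HasDerivAt (expVec A y) (A.mulVec (expVec A y t)) t :=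
    hasDerivAt_pi.2 (hasDerivAt_expVec_apply A y t)
  rw [← hasDerivWithinAt_univ] at hx hy ⊢
  convert! hasDerivWithinAt_dotProduct_mulVec P hx hy using 1
  rw [mulVec_dotProduct, ← dotProduct_add, Matrix.mulVec_mulVec, Matrix.mulVec_mulVec,
    ← Matrix.add_mulVec, hP, Matrix.neg_mulVec, dotProduct_neg]

lemma tendsto_expVec_dotProduct {n : ℕ} {A : Matrix (Fin n) (Fin n) ℝ} (hA : IsHurwitz A)
    (P : Matrix (Fin n) (Fin n) ℝ) (x y : Fin n → ℝ) :
    Filter.Tendsto (fun u => expVec A x u ⬝ᵥ P.mulVec (expVec A y u)) Filter.atTop (nhds 0) := by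
  have h : Filter.Tendsto (fun u => ∑ i, expVec A x u i * ∑ j, P i j * expVec A y u j)
      Filter.atTop (nhds (∑ i : Fin n, 0 * ∑ j, P i j * 0)) :=
    tendsto_finsetSum _ fun i _ => (tendsto_expVec_apply hA x i).mul
      (tendsto_finsetSum _ fun j _ => (tendsto_expVec_apply hA y j).const_mul _)
  simp only [zero_mul, Finset.sum_const_zero] at h
  exact h

/-- The bilinear form of `D` is constant along pairs of solutions of `ẏ = A y`, and these decay to
zero. -/
lemma eq_zero_of_lyapunov {n : ℕ} {A D : Matrix (Fin n) (Fin n) ℝ} (hA : IsHurwitz A)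
    (hD : A.transpose * D + D * A = 0) : D = 0 := by
  have key : ∀ x y : Fin n → ℝ, x ⬝ᵥ D.mulVec y = 0 := by
    intro x y
    have hd : ∀ t, HasDerivAt (fun u => expVec A x u ⬝ᵥ D.mulVec (expVec A y u)) 0 t := by
      intro t
      have := hasDerivAt_expVec_dotProduct (Q := 0) (by rw [hD, neg_zero]) x y t
      simpa using this
    have hconst := is_const_of_deriv_eq_zero (fun t => (hd t).differentiableAt)
      (fun t => (hd t).deriv)
    have hl := tendsto_expVec_dotProduct hA D x y
    have h0 : Filter.Tendsto (fun u => expVec A x u ⬝ᵥ D.mulVec (expVec A y u)) Filter.atTop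
        (nhds (x ⬝ᵥ D.mulVec y)) := by
      refine tendsto_const_nhds.congr fun u => ?_
      rw [hconst u 0, expVec_zero, expVec_zero]
    exact tendsto_nhds_unique h0 hl
  ext i j
  simpa using key (Pi.single i 1) (Pi.single j 1)

/-- `P` and its transpose solve the same equation, whose solution is unique. -/
lemma transpose_eq_of_lyapunov {n : ℕ} {A P Q : Matrix (Fin n) (Fin n) ℝ} (hA : IsHurwitz A)
    (hQ : Q.transpose = Q) (hP : A.transpose * P + P * A = -Q) : P.transpose = P := by
  rw [← sub_eq_zero]
  refine eq_zero_of_lyapunov hA ?_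
  have h := congrArg Matrix.transpose hP
  rw [Matrix.transpose_add, Matrix.transpose_mul, Matrix.transpose_mul,
    Matrix.transpose_transpose, Matrix.transpose_neg, hQ] at h
  rw [mul_sub, sub_mul]
  linear_combination (norm := abel) h - hP

/-- Along `exp (t A) x` the quadratic form of `P` strictly decreases to the limit zero, so it starts
positive. -/
lemma dotProduct_mulVec_pos_of_lyapunov {n : ℕ} {A P Q : Matrix (Fin n) (Fin n) ℝ}
    (hA : IsHurwitz A) (hQ : ∀ x : Fin n → ℝ, x ≠ 0 → 0 < x ⬝ᵥ Q.mulVec x)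
    (hP : A.transpose * P + P * A = -Q) (x : Fin n → ℝ) (hx : x ≠ 0) :
    0 < x ⬝ᵥ P.mulVec x := by
  have hd := hasDerivAt_expVec_dotProduct hP x x
  have hne : ∀ t, expVec A x t ≠ 0 := by
    intro t h
    refine hx (Matrix.mulVec_injective_of_isUnit (Matrix.isUnit_exp (t • A)) ?_)
    rw [Matrix.mulVec_zero]
    exact h
  have hanti : StrictAnti fun u => expVec A x u ⬝ᵥ P.mulVec (expVec A x u) :=
    strictAnti_of_deriv_neg fun t => by
      rw [(hd t).deriv]
      exact neg_neg_of_pos (hQ _ (hne t))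
  have h1 := hanti.antitone.le_of_tendsto (tendsto_expVec_dotProduct hA P x x) 1
  have h2 := hanti zero_lt_one
  simp only [expVec_zero] at h2
  linarith

lemma exists_coercive {n : ℕ} {P : Matrix (Fin n) (Fin n) ℝ}
    (hP : ∀ x : Fin n → ℝ, x ≠ 0 → 0 < x ⬝ᵥ P.mulVec x) :
    ∃ m : ℝ, 0 < m ∧ ∀ x : Fin n → ℝ, m * ‖x‖ ^ 2 ≤ x ⬝ᵥ P.mulVec x := by
  have hcont : Continuous fun x : Fin n → ℝ => x ⬝ᵥ P.mulVec x := by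
    simp only [Matrix.mulVec, dotProduct]
    fun_prop
  -- The unit sphere is empty when `n = 0`; otherwise the constant is the minimum of the form on it.
  rcases (Metric.sphere (0 : Fin n → ℝ) 1).eq_empty_or_nonempty with he | hne
  · refine ⟨1, one_pos, fun x => ?_⟩
    by_cases hx : x = 0
    · simp [hx]
    · exfalso
      have : ‖x‖⁻¹ • x ∈ Metric.sphere (0 : Fin n → ℝ) 1 := by
        simp [norm_smul, norm_ne_zero_iff.2 hx]
      rw [he] at this
      exact this
  · obtain ⟨e, he, hmin⟩ := (isCompact_sphere (0 : Fin n → ℝ) 1).exists_isMinOn hne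
      hcont.continuousOn
    have he0 : e ≠ 0 := fun h => by simp [h] at he
    refine ⟨e ⬝ᵥ P.mulVec e, hP e he0, fun x => ?_⟩
    by_cases hx : x = 0
    · simp [hx]
    · have hn : ‖x‖ ≠ 0 := norm_ne_zero_iff.2 hx
      have hm : ‖x‖⁻¹ • x ∈ Metric.sphere (0 : Fin n → ℝ) 1 := by
        simp [norm_smul, hn]
      have h := hmin hm
      simp only [Set.mem_ofPred_eq, Matrix.mulVec_smul, dotProduct_smul, smul_dotProduct,
        smul_eq_mul] at h
      calc e ⬝ᵥ P.mulVec e * ‖x‖ ^ 2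
          ≤ (‖x‖⁻¹ * (‖x‖⁻¹ * (x ⬝ᵥ P.mulVec x))) * ‖x‖ ^ 2 := by gcongr
        _ = x ⬝ᵥ P.mulVec x := by field_simp

/-! ### The adaptive law -/

lemma intervalIntegrable_of_integrableOn_Icc {E : Type*} [NormedAddCommGroup E] {v : ℝ → E}
    (hv : ∀ T, 0 ≤ T → IntegrableOn v (Set.Icc 0 T)) {a b : ℝ} (ha : 0 ≤ a) (hab : a ≤ b) :
    IntervalIntegrable v volume a b := by
  rw [intervalIntegrable_iff_integrableOn_Ioc_of_le hab]
  exact (hv b (ha.trans hab)).mono_set fun t ht => ⟨ha.trans ht.1.le, ht.2⟩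

lemma continuousOn_integral_Ici {E : Type*} [NormedAddCommGroup E] [NormedSpace ℝ E]
    {v : ℝ → E} (hv : ∀ T, 0 ≤ T → IntegrableOn v (Set.Icc 0 T)) :
    ContinuousOn (fun t => ∫ τ in (0 : ℝ)..t, v τ) (Set.Ici 0) := by
  intro t ht
  have h1 : ContinuousOn (fun t => ∫ τ in (0 : ℝ)..t, v τ) (Set.Icc 0 (t + 1)) := by
    have := intervalIntegral.continuousOn_primitive_interval (μ := volume) (a := 0) (b := t + 1)
      (f := v)
    rw [Set.uIcc_of_le (by linarith [Set.mem_Ici.1 ht])] at this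
    exact this (hv _ (by linarith [Set.mem_Ici.1 ht]))
  refine (h1 t ⟨ht, by linarith⟩).mono_of_mem_nhdsWithin ?_
  rw [← Set.Ici_inter_Iic]
  exact Filter.inter_mem self_mem_nhdsWithin (nhdsWithin_le_nhds (Iic_mem_nhds (by linarith)))

/-- A trajectory whose velocity lies in the tangent cone of a closed convex set does not leave
the set. -/
lemma mem_of_velocity_mem_tangentCone {n : ℕ} {Ω : Set (Fin n → ℝ)} (hΩc : IsClosed Ω)
    (hΩ : Convex ℝ Ω) {Γ : ℝ} (hΓ : 0 < Γ) {z₀ : Fin n → ℝ} (hz₀ : z₀ ∈ Ω)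
    {z v : ℝ → Fin n → ℝ} (hv : ∀ T, 0 ≤ T → IntegrableOn v (Set.Icc 0 T))
    (hT : ∀ᵐ t ∂(volume.restrict (Set.Ici (0 : ℝ))), v t ∈ tangentCone Ω (z t))
    (hz : ∀ t, 0 ≤ t → z t = z₀ + Γ • ∫ τ in (0 : ℝ)..t, v τ) {t : ℝ} (ht : 0 ≤ t) :
    z t ∈ Ω := by
  by_contra hnot
  -- A functional `f` separates the escaped point from `Ω`. After the last time `t₀` with `f (z t₀)
  -- ≤ u`, the curve lies beyond the level `u`, where every tangent direction has `f ≤ 0`; so `f ∘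
  -- z` cannot have risen above `u`.
  obtain ⟨f, u, hfu, hu⟩ := geometric_hahn_banach_closed_point hΩ hΩc hnot
  have hcone : ∀ w y : Fin n → ℝ, w ∈ tangentCone Ω y → u ≤ f y → f w ≤ 0 := by
    intro w y hw hy
    have hcl : IsClosed {w | f w ≤ 0} := isClosed_le f.continuous continuous_const
    refine closure_minimal ?_ hcl hw
    rintro _ ⟨s, hs, p, hp, rfl⟩
    change f (s • (p - y)) ≤ 0
    rw [map_smul, map_sub, smul_eq_mul]
    exact mul_nonpos_of_nonneg_of_nonpos hs (by linarith [hfu p hp])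
  have hfz : ContinuousOn (fun τ => f (z τ)) (Set.Ici 0) := by
    refine f.continuous.comp_continuousOn ?_
    refine ((continuousOn_integral_Ici hv).const_smul Γ |>.const_add z₀).congr hz
  set S : Set ℝ := Set.Icc 0 t ∩ (fun τ => f (z τ)) ⁻¹' Set.Iic u with hS
  have hSc : IsClosed S :=
    (hfz.mono Set.Icc_subset_Ici_self).preimage_isClosed_of_isClosed isClosed_Icc isClosed_Iic
  have hSne : S.Nonempty := ⟨0, ⟨le_refl 0, ht⟩, by
    change f (z 0) ≤ u
    rw [hz 0 le_rfl]
    simpa using (hfu z₀ hz₀).le⟩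
  have hSb : BddAbove S := ⟨t, fun τ hτ => hτ.1.2⟩
  obtain ⟨⟨h0, h0t⟩, hle⟩ := hSc.csSup_mem hSne hSb
  set t₀ := sSup S with ht₀
  have hlt : ∀ τ, t₀ < τ → τ ≤ t → u < f (z τ) := by
    intro τ h1 h2
    by_contra h3
    have : τ ∈ S := ⟨⟨h0.trans h1.le, h2⟩, not_lt.1 h3⟩
    exact absurd (le_csSup hSb this) (not_le.2 h1)
  have hint : ∀ {a b : ℝ}, 0 ≤ a → a ≤ b → IntervalIntegrable v volume a b :=
    fun ha hab => intervalIntegrable_of_integrableOn_Icc hv ha hab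
  have hdiff : z t - z t₀ = Γ • ∫ τ in t₀..t, v τ := by
    rw [hz t ht, hz t₀ h0, ← intervalIntegral.integral_add_adjacent_intervals
      (hint le_rfl h0) (hint h0 h0t), smul_add]
    abel
  have hneg : ∫ τ in t₀..t, f (v τ) ≤ 0 := by
    rw [intervalIntegral.integral_of_le h0t]
    refine setIntegral_nonpos_of_ae_restrict ?_
    have hsub : Set.Ioc t₀ t ⊆ Set.Ici 0 := fun τ hτ => h0.trans hτ.1.le
    filter_upwards [ae_restrict_of_ae_restrict_of_subset hsub hT,
      ae_restrict_mem measurableSet_Ioc] with τ h1 h2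
    exact hcone _ _ h1 (hlt τ h2.1 h2.2).le
  have h4 : f (z t) - f (z t₀) = Γ * ∫ τ in t₀..t, f (v τ) := by
    rw [← map_sub, hdiff, map_smul, smul_eq_mul,
      f.intervalIntegral_comp_comm (hint h0 h0t)]
  have h5 : f (z t₀) ≤ u := hle
  nlinarith

/-- A sum of two scaled directions into `Ω` is one direction, with scale `s + ε`, towards a convex
combination of the targets; closure preserves this. -/
lemma add_smul_mem_tangentCone {n : ℕ} {Ω : Set (Fin n → ℝ)} (hΩ : Convex ℝ Ω)
    {z v θ : Fin n → ℝ} (hv : v ∈ tangentCone Ω z) (hθ : θ ∈ Ω) {ε : ℝ} (hε : 0 < ε) :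
    v + ε • (θ - z) ∈ tangentCone Ω z := by
  refine map_mem_closure (f := fun w => w + ε • (θ - z)) (by fun_prop) hv ?_
  rintro _ ⟨s, hs, w, hw, rfl⟩
  have hp : 0 < s + ε := by linarith
  refine ⟨s + ε, hp.le, (s / (s + ε)) • w + (ε / (s + ε)) • θ,
    hΩ hw hθ (by positivity) (by positivity) (by field_simp), ?_⟩
  ext i
  simp
  field_simp
  ring

/-- First-order optimality of the projection: compare `v` with the competitor `v + ε (θ - z)` and
let `ε` be small. -/
lemma IsProj.dotProduct_nonpos {n : ℕ} {Ω : Set (Fin n → ℝ)} (hΩ : Convex ℝ Ω)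
    {z y v θ : Fin n → ℝ} (h : IsProj Ω z y v) (hθ : θ ∈ Ω) :
    (y - v) ⬝ᵥ (θ - z) ≤ 0 := by
  have key : ∀ ε : ℝ, 0 < ε →
      2 * ((y - v) ⬝ᵥ (θ - z)) ≤ ε * ((θ - z) ⬝ᵥ (θ - z)) := by
    intro ε hε
    have h1 := h.2 _ (add_smul_mem_tangentCone hΩ h.1 hθ hε)
    have h2 : ∑ i, (y i - (v + ε • (θ - z)) i) ^ 2 = ∑ i, (y i - v i) ^ 2
        - 2 * ε * ((y - v) ⬝ᵥ (θ - z)) + ε ^ 2 * ((θ - z) ⬝ᵥ (θ - z)) := by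
      simp only [dotProduct, Finset.mul_sum, ← Finset.sum_sub_distrib, ← Finset.sum_add_distrib]
      refine Finset.sum_congr rfl fun i _ => ?_
      simp
      ring
    rw [h2] at h1
    have h3 : ε * (2 * ((y - v) ⬝ᵥ (θ - z))) ≤ ε * (ε * ((θ - z) ⬝ᵥ (θ - z))) := by linarith
    exact le_of_mul_le_mul_left h3 hε
  by_contra hpos
  push Not at hpos
  have hd : 0 ≤ (θ - z) ⬝ᵥ (θ - z) := by
    simp only [dotProduct]
    exact Finset.sum_nonneg fun i _ => mul_self_nonneg _
  -- This `ε` makes the quadratic term smaller than the linear one; the `+ 1` avoids a zero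
  -- denominator.
  have h4 := key (((y - v) ⬝ᵥ (θ - z)) / ((θ - z) ⬝ᵥ (θ - z) + 1)) (by positivity)
  rw [div_mul_eq_mul_div, le_div_iff₀ (by linarith)] at h4
  nlinarith

/-- Integration by parts for the absolutely continuous primitive of `w`. It replaces differentiation
of `|θ̂ - θ|²`, as the adaptive law holds only almost everywhere. -/
lemma sq_sub_sq_eq_integral {w : ℝ → ℝ} {T a Γ : ℝ}
    (hw : IntervalIntegrable w volume 0 T) :
    (a + Γ * ∫ τ in (0 : ℝ)..T, w τ) ^ 2 - a ^ 2
      = 2 * Γ * ∫ t in (0 : ℝ)..T, (a + Γ * ∫ τ in (0 : ℝ)..t, w τ) * w t := by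
  have hac := hw.absolutelyContinuousOnInterval_intervalIntegral (c := 0) (by simp)
  have h := hac.integral_deriv_mul_eq_sub hac
  have hF : IntervalIntegrable (fun t => (∫ τ in (0 : ℝ)..t, w τ) * w t) volume 0 T :=
    hw.continuousOn_mul hac.continuousOn
  have h2 : ∫ x in (0 : ℝ)..T, (deriv (fun t => ∫ τ in (0 : ℝ)..t, w τ) x
        * (∫ τ in (0 : ℝ)..x, w τ)
        + (∫ τ in (0 : ℝ)..x, w τ) * deriv (fun t => ∫ τ in (0 : ℝ)..t, w τ) x)
      = ∫ t in (0 : ℝ)..T, 2 * ((∫ τ in (0 : ℝ)..t, w τ) * w t) := by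
    refine intervalIntegral.integral_congr_ae ?_
    filter_upwards [hw.ae_hasDerivAt_integral] with t h3 h4
    rw [(h3 (Set.uIoc_subset_uIcc h4) 0 (by simp)).deriv]
    ring
  rw [h2, intervalIntegral.integral_const_mul] at h
  simp only [intervalIntegral.integral_same, mul_zero, sub_zero] at h
  have h5 : ∫ t in (0 : ℝ)..T, (a + Γ * ∫ τ in (0 : ℝ)..t, w τ) * w t
      = a * (∫ τ in (0 : ℝ)..T, w τ) + Γ * ∫ t in (0 : ℝ)..T, (∫ τ in (0 : ℝ)..t, w τ) * w t := by
    rw [← intervalIntegral.integral_const_mul, ← intervalIntegral.integral_const_mul,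
      ← intervalIntegral.integral_add (hw.const_mul a) (hF.const_mul Γ)]
    refine intervalIntegral.integral_congr fun t _ => ?_
    ring
  rw [h5]
  linear_combination -Γ ^ 2 * h

/-- The Lyapunov estimate for the prediction error. -/
lemma lyapunov_estimate {n : ℕ} {A P Q : Matrix (Fin n) (Fin n) ℝ} {b : Fin n → ℝ}
    (hPs : P.transpose = P) (hP : A.transpose * P + P * A = -Q)
    {Ω : Set (Fin n → ℝ)} (hΩ : Convex ℝ Ω) {θ z₀ : Fin n → ℝ} (hθ : θ ∈ Ω)
    {Γ : ℝ} (hΓ : 0 < Γ) {x e z v : ℝ → Fin n → ℝ} (hx : ContinuousOn x (Set.Ici 0))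
    (he0 : e 0 = 0)
    (he : ∀ t, 0 ≤ t →
      HasDerivWithinAt e (A.mulVec (e t) - ((z t - θ) ⬝ᵥ x t) • b) (Set.Ici 0) t)
    (hv : ∀ T, 0 ≤ T → IntegrableOn v (Set.Icc 0 T))
    (hproj : ∀ᵐ t ∂(volume.restrict (Set.Ici (0 : ℝ))),
      IsProj Ω (z t) ((e t ⬝ᵥ P.mulVec b) • x t) (v t))
    (hz : ∀ t, 0 ≤ t → z t = z₀ + Γ • ∫ τ in (0 : ℝ)..t, v τ) {T : ℝ} (hT : 0 ≤ T) :
    Γ * (e T ⬝ᵥ P.mulVec (e T)) + Γ * (∫ t in (0 : ℝ)..T, e t ⬝ᵥ Q.mulVec (e t))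
      ≤ ∑ i, (z₀ i - θ i) ^ 2 := by
  have hzc : ContinuousOn z (Set.Ici 0) :=
    ((continuousOn_integral_Ici hv).const_smul Γ |>.const_add z₀).congr hz
  have hec : ContinuousOn e (Set.Ici 0) := fun t ht => (he t ht).continuousWithinAt
  have hxi := continuousOn_pi.1 hx
  have hzi := continuousOn_pi.1 hzc
  have hei := continuousOn_pi.1 hec
  have hQc : ContinuousOn (fun t => e t ⬝ᵥ Q.mulVec (e t)) (Set.Ici 0) := by
    simp only [Matrix.mulVec, dotProduct]
    fun_prop
  have hbc : ContinuousOn (fun t => e t ⬝ᵥ P.mulVec b) (Set.Ici 0) := by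
    simp only [Matrix.mulVec, dotProduct]
    fun_prop
  have hzx : ContinuousOn (fun t => (z t - θ) ⬝ᵥ x t) (Set.Ici 0) := by
    simp only [dotProduct, Pi.sub_apply]
    fun_prop
  have hsub : Set.uIcc 0 T ⊆ Set.Ici 0 := by
    rw [Set.uIcc_of_le hT]
    exact Set.Icc_subset_Ici_self
  have hgc : ContinuousOn (fun t => ((z t - θ) ⬝ᵥ x t) * (e t ⬝ᵥ P.mulVec b)) (Set.Ici 0) :=
    hzx.mul hbc
  have hQi := (hQc.mono hsub).intervalIntegrable (μ := volume)
  have hgi := (hgc.mono hsub).intervalIntegrable (μ := volume)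
  -- the quadratic part
  have hW : ∀ t, 0 ≤ t → HasDerivWithinAt (fun t => e t ⬝ᵥ P.mulVec (e t))
      (-(e t ⬝ᵥ Q.mulVec (e t)) - 2 * (((z t - θ) ⬝ᵥ x t) * (e t ⬝ᵥ P.mulVec b)))
      (Set.Ici 0) t := by
    intro t ht
    convert! hasDerivWithinAt_dotProduct_mulVec P (he t ht) (he t ht) using 1
    have h1 : A.mulVec (e t) ⬝ᵥ P.mulVec (e t) + e t ⬝ᵥ P.mulVec (A.mulVec (e t))
        = -(e t ⬝ᵥ Q.mulVec (e t)) := by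
      rw [mulVec_dotProduct, ← dotProduct_add, Matrix.mulVec_mulVec, Matrix.mulVec_mulVec,
        ← Matrix.add_mulVec, hP, Matrix.neg_mulVec, dotProduct_neg]
    have h2 : b ⬝ᵥ P.mulVec (e t) = e t ⬝ᵥ P.mulVec b := by
      rw [dotProduct_comm, mulVec_dotProduct, hPs]
    generalize (z t - θ) ⬝ᵥ x t = c
    rw [sub_dotProduct, Matrix.mulVec_sub, dotProduct_sub, Matrix.mulVec_smul, dotProduct_smul,
      smul_dotProduct, h2, ← h1]
    simp only [smul_eq_mul]
    ring
  have hQn : IntervalIntegrable (fun t => -(e t ⬝ᵥ Q.mulVec (e t))) volume 0 T := hQi.neg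
  have hWint := intervalIntegral.integral_eq_sub_of_hasDerivAt_of_le hT
    (fun t ht => ((hW t ht.1).continuousWithinAt).mono Set.Icc_subset_Ici_self)
    (fun t ht => (hW t ht.1.le).hasDerivAt (Ici_mem_nhds ht.1))
    (hQn.sub (hgi.const_mul 2))
  rw [intervalIntegral.integral_sub hQn (hgi.const_mul 2), intervalIntegral.integral_neg,
    intervalIntegral.integral_const_mul, he0] at hWint
  simp only [zero_dotProduct, sub_zero] at hWint
  -- the parameter part
  have hvi : ∀ i, IntervalIntegrable (fun t => v t i) volume 0 T := fun i => by
    have h := intervalIntegrable_of_integrableOn_Icc hv le_rfl hT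
    exact ⟨(ContinuousLinearMap.proj (R := ℝ) (φ := fun _ : Fin n => ℝ) i).integrable_comp h.1,
      (ContinuousLinearMap.proj (R := ℝ) (φ := fun _ : Fin n => ℝ) i).integrable_comp h.2⟩
  have hzti : ∀ i t, 0 ≤ t → z t i - θ i = (z₀ i - θ i) + Γ * ∫ τ in (0 : ℝ)..t, v τ i := by
    intro i t ht
    have h := (ContinuousLinearMap.proj (R := ℝ) (φ := fun _ : Fin n => ℝ) i).intervalIntegral_comp_comm
      (intervalIntegrable_of_integrableOn_Icc hv le_rfl ht)
    simp only [ContinuousLinearMap.proj_apply] at h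
    rw [h, hz t ht]
    simp only [Pi.add_apply, Pi.smul_apply, smul_eq_mul]
    ring
  have hzvi : ∀ i, IntervalIntegrable (fun t => (z t i - θ i) * v t i) volume 0 T := fun i =>
    (hvi i).continuousOn_mul (((hzi i).sub continuousOn_const).mono hsub)
  have hsq : ∑ i, (z T i - θ i) ^ 2 - ∑ i, (z₀ i - θ i) ^ 2
      = 2 * Γ * ∫ t in (0 : ℝ)..T, (z t - θ) ⬝ᵥ v t := by
    simp only [dotProduct, Pi.sub_apply]
    rw [intervalIntegral.integral_finsetSum fun i _ => hzvi i, Finset.mul_sum,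
      ← Finset.sum_sub_distrib]
    refine Finset.sum_congr rfl fun i _ => ?_
    rw [hzti i T hT, sq_sub_sq_eq_integral (hvi i)]
    congr 1
    refine intervalIntegral.integral_congr fun t ht => ?_
    rw [hzti i t (hsub ht)]
  have hzv : IntervalIntegrable (fun t => (z t - θ) ⬝ᵥ v t) volume 0 T := by
    simp only [dotProduct, Pi.sub_apply]
    have := IntervalIntegrable.sum Finset.univ fun i _ => hzvi i
    convert! this using 1
    funext t
    simp
  -- The projection inequality bounds the parameter term by the cross term of the quadratic part,
  -- which then cancels.
  have hmono : ∫ t in (0 : ℝ)..T, (z t - θ) ⬝ᵥ v t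
      ≤ ∫ t in (0 : ℝ)..T, ((z t - θ) ⬝ᵥ x t) * (e t ⬝ᵥ P.mulVec b) := by
    refine intervalIntegral.integral_mono_ae_restrict hT hzv hgi ?_
    filter_upwards [ae_restrict_of_ae_restrict_of_subset Set.Icc_subset_Ici_self hproj] with t ht
    have h := ht.dotProduct_nonpos hΩ hθ
    have h2 : ((e t ⬝ᵥ P.mulVec b) • x t - v t) ⬝ᵥ (θ - z t)
        = (z t - θ) ⬝ᵥ v t - ((z t - θ) ⬝ᵥ x t) * (e t ⬝ᵥ P.mulVec b) := by
      rw [← neg_sub (z t) θ, dotProduct_neg, sub_dotProduct, smul_dotProduct, smul_eq_mul,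
        dotProduct_comm (x t), dotProduct_comm (v t)]
      ring
    linarith
  have hnn : 0 ≤ ∑ i, (z T i - θ i) ^ 2 := Finset.sum_nonneg fun i _ => sq_nonneg _
  have := mul_le_mul_of_nonneg_left hmono (by linarith : 0 ≤ 2 * Γ)
  nlinarith

/-! ### The forced response -/

/-- Fubini on the triangle `σ ≤ τ`, encoded by an indicator on the square, followed by a shift of
the inner variable by `σ`. -/
lemma conv_assoc {f g v : ℝ → ℝ} (hf : Continuous f) (hg : Continuous g) (hv : Continuous v)
    {t : ℝ} (ht : 0 ≤ t) : conv f (conv g v) t = conv (conv f g) v t := by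
  set G : ℝ → ℝ → ℝ := fun τ σ => f (t - τ) * (g (τ - σ) * v σ) with hG
  have hGc : Continuous (Function.uncurry G) := by
    simp only [hG, Function.uncurry_def]
    fun_prop
  set F : ℝ → ℝ → ℝ := fun τ σ => {p : ℝ × ℝ | p.2 ≤ p.1}.indicator (Function.uncurry G) (τ, σ)
    with hF
  have hmeas : MeasurableSet {p : ℝ × ℝ | p.2 ≤ p.1} :=
    (isClosed_le continuous_snd continuous_fst).measurableSet
  have hFi : IntegrableOn (Function.uncurry F) (Set.uIoc 0 t ×ˢ Set.uIoc 0 t) := by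
    have h : IntegrableOn (Function.uncurry G) (Set.uIoc 0 t ×ˢ Set.uIoc 0 t) :=
      (hGc.continuousOn.integrableOn_compact (isCompact_uIcc.prod isCompact_uIcc)).mono_set
        (Set.prod_mono Set.uIoc_subset_uIcc Set.uIoc_subset_uIcc)
    exact h.indicator hmeas
  have hswap := intervalIntegral_intervalIntegral_swap hFi
  have hl : conv f (conv g v) t = ∫ τ in (0 : ℝ)..t, ∫ σ in (0 : ℝ)..t, F τ σ := by
    rw [conv]
    refine intervalIntegral.integral_congr fun τ hτ => ?_
    rw [Set.uIcc_of_le ht] at hτ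
    have h := intervalIntegral.integral_indicator (f := G τ) (μ := volume) hτ
    have h2 : ∀ σ, F τ σ = {σ | σ ≤ τ}.indicator (G τ) σ := fun σ => by
      simp [hF, Set.indicator_apply]
    simp_rw [h2]
    rw [h, conv, ← intervalIntegral.integral_const_mul]
  have hr : conv (conv f g) v t = ∫ σ in (0 : ℝ)..t, ∫ τ in (0 : ℝ)..t, F τ σ := by
    rw [conv, intervalIntegral.integral_of_le ht, intervalIntegral.integral_of_le ht]
    refine setIntegral_congr_fun measurableSet_Ioc fun σ hσ => ?_
    have h2 : ∀ τ, F τ σ = (Set.Ici σ).indicator (fun τ => G τ σ) τ := fun τ => by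
      simp [hF, Set.indicator_apply]
    have h3 : Set.Ioc 0 t ∩ Set.Ici σ = Set.Icc σ t := by
      ext τ
      simp only [Set.mem_inter_iff, Set.mem_Ioc, Set.mem_Ici, Set.mem_Icc]
      exact ⟨fun h => ⟨h.2, h.1.2⟩, fun h => ⟨⟨hσ.1.trans_le h.1, h.2⟩, h.1⟩⟩
    simp only [h2]
    rw [intervalIntegral.integral_of_le ht, setIntegral_indicator measurableSet_Ici, h3,
      integral_Icc_eq_integral_Ioc, ← intervalIntegral.integral_of_le hσ.2, conv,
      ← intervalIntegral.integral_mul_const]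
    have h4 := intervalIntegral.integral_comp_sub_right (a := σ) (b := t)
      (fun ρ => f (t - σ - ρ) * g ρ * v σ) σ
    rw [sub_self] at h4
    rw [← h4]
    refine intervalIntegral.integral_congr fun τ _ => ?_
    simp only [hG]
    rw [show t - σ - (τ - σ) = t - τ by ring]
    ring
  rw [hl, hr, hswap]

lemma intervalIntegrable_conv_integrand {f v : ℝ → ℝ} (hf : Continuous f) (hv : Continuous v)
    (t : ℝ) : IntervalIntegrable (fun τ => f (t - τ) * v τ) volume 0 t :=
  (by fun_prop : Continuous fun τ => f (t - τ) * v τ).intervalIntegrable _ _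

lemma conv_add_right {f v w : ℝ → ℝ} (hf : Continuous f) (hv : Continuous v) (hw : Continuous w)
    (t : ℝ) : conv f (fun τ => v τ + w τ) t = conv f v t + conv f w t := by
  simp only [conv, mul_add]
  exact intervalIntegral.integral_add (intervalIntegrable_conv_integrand hf hv t)
    (intervalIntegrable_conv_integrand hf hw t)

lemma conv_sub_right {f v w : ℝ → ℝ} (hf : Continuous f) (hv : Continuous v) (hw : Continuous w)
    (t : ℝ) : conv f (fun τ => v τ - w τ) t = conv f v t - conv f w t := by
  simp only [conv, mul_sub]
  exact intervalIntegral.integral_sub (intervalIntegrable_conv_integrand hf hv t)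
    (intervalIntegrable_conv_integrand hf hw t)

lemma conv_sub_left {f g v : ℝ → ℝ} (hf : Continuous f) (hg : Continuous g) (hv : Continuous v)
    (t : ℝ) : conv (fun τ => f τ - g τ) v t = conv f v t - conv g v t := by
  simp only [conv, sub_mul]
  exact intervalIntegral.integral_sub (intervalIntegrable_conv_integrand hf hv t)
    (intervalIntegrable_conv_integrand hg hv t)

/-- By causality only the bound of `v` on `[0, t]` enters, as the small-gain argument requires. -/
lemma abs_conv_le {f v : ℝ → ℝ} (hf : Continuous f) (hfi : IntegrableOn f (Set.Ioi 0))
    {t B : ℝ} (ht : 0 ≤ t) (hB : ∀ τ ∈ Set.Icc 0 t, |v τ| ≤ B) :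
    |conv f v t| ≤ (∫ τ in Set.Ioi (0 : ℝ), |f τ|) * B := by
  have hB0 : 0 ≤ B := (abs_nonneg _).trans (hB 0 ⟨le_rfl, ht⟩)
  have h1 : |conv f v t| ≤ ∫ τ in (0 : ℝ)..t, |f (t - τ)| * B := by
    rw [conv, ← Real.norm_eq_abs]
    refine intervalIntegral.norm_integral_le_of_norm_le ht
      (Filter.Eventually.of_forall fun τ hτ => ?_)
      ((by fun_prop : Continuous fun τ => |f (t - τ)| * B).intervalIntegrable _ _)
    rw [Real.norm_eq_abs, abs_mul]
    exact mul_le_mul_of_nonneg_left (hB τ ⟨hτ.1.le, hτ.2⟩) (abs_nonneg _)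
  refine h1.trans ?_
  rw [intervalIntegral.integral_mul_const]
  refine mul_le_mul_of_nonneg_right ?_ hB0
  rw [intervalIntegral.integral_comp_sub_left (fun τ => |f τ|) t, sub_self, sub_zero,
    intervalIntegral.integral_of_le ht]
  exact setIntegral_mono_set hfi.abs (Filter.Eventually.of_forall fun _ => abs_nonneg _)
    (Filter.Eventually.of_forall fun τ hτ => hτ.1)

/-- Variation of constants. -/
lemma eq_expVec_add_conv {n : ℕ} {A : Matrix (Fin n) (Fin n) ℝ} {b : Fin n → ℝ}
    {y : ℝ → Fin n → ℝ} {w : ℝ → ℝ} (hw : Continuous w)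
    (hy : ∀ t, 0 ≤ t → HasDerivWithinAt y (A.mulVec (y t) + w t • b) (Set.Ici 0) t)
    (i : Fin n) {t : ℝ} (ht : 0 ≤ t) :
    y t i = expVec A (y 0) t i + conv (fun t => expVec A b t i) w t := by
  have hE : ∀ (j : Fin n) (τ : ℝ), HasDerivAt (fun τ => NormedSpace.exp ((t - τ) • A) i j)
      (-((NormedSpace.exp ((t - τ) • A) * A) i j)) τ := by
    intro j τ
    have h := (hasDerivAt_exp_apply A i j (t - τ)).scomp τ ((hasDerivAt_id τ).const_sub t)
    simpa using! h
  -- In the derivative of `exp ((t - τ) A) y(τ)` the terms with `A y` cancel, leaving the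
  -- convolution integrand.
  have hd : ∀ τ, 0 ≤ τ → HasDerivWithinAt
      (fun τ => ((NormedSpace.exp ((t - τ) • A)).mulVec (y τ)) i)
      (expVec A b (t - τ) i * w τ) (Set.Ici 0) τ := by
    intro τ hτ
    have h : HasDerivWithinAt (fun τ => ∑ j, NormedSpace.exp ((t - τ) • A) i j * y τ j)
        (∑ j, (-((NormedSpace.exp ((t - τ) • A) * A) i j) * y τ j
          + NormedSpace.exp ((t - τ) • A) i j * (A.mulVec (y τ) + w τ • b) j)) (Set.Ici 0) τ :=
      HasDerivWithinAt.fun_sum fun j _ => ((hE j τ).hasDerivWithinAt).mul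
        (hasDerivWithinAt_pi.1 (hy τ hτ) j)
    refine h.congr_deriv ?_
    rw [Finset.sum_add_distrib]
    change _ + (NormedSpace.exp ((t - τ) • A)).mulVec (A.mulVec (y τ) + w τ • b) i = _
    rw [Matrix.mulVec_add, Matrix.mulVec_smul, Matrix.mulVec_mulVec]
    simp only [neg_mul, Finset.sum_neg_distrib]
    change -((NormedSpace.exp ((t - τ) • A) * A).mulVec (y τ) i) + _ = _
    simp only [Pi.add_apply, Pi.smul_apply, smul_eq_mul, expVec]
    ring
  have hc := continuous_expVec_apply A b i
  have h := intervalIntegral.integral_eq_sub_of_hasDerivAt_of_le ht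
    (fun τ hτ => ((hd τ hτ.1).continuousWithinAt).mono Set.Icc_subset_Ici_self)
    (fun τ hτ => (hd τ hτ.1.le).hasDerivAt (Ici_mem_nhds hτ.1))
    (intervalIntegrable_conv_integrand hc hw t)
  rw [sub_self, zero_smul, NormedSpace.exp_zero, Matrix.one_mulVec, sub_zero] at h
  rw [conv, h, expVec]
  ring

/-- The state predictor in terms of `Ḡ` and the reference input. -/
lemma predictor_eq {n : ℕ} {A : Matrix (Fin n) (Fin n) ℝ} {b : Fin n → ℝ}
    {y : ℝ → Fin n → ℝ} {f ρ ν : ℝ → ℝ} (hf : Continuous f) (hρ : Continuous ρ)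
    (hν : Continuous ν)
    (hy : ∀ t, 0 ≤ t → HasDerivWithinAt y
      (A.mulVec (y t) + (conv f (fun τ => ρ τ + ν τ) t - ρ t) • b) (Set.Ici 0) t)
    (i : Fin n) {t : ℝ} (ht : 0 ≤ t) :
    y t i = expVec A (y 0) t i
      + conv (fun t => conv (fun t => expVec A b t i) f t - expVec A b t i) ρ t
      + conv (conv (fun t => expVec A b t i) f) ν t := by
  have hc := continuous_expVec_apply A b i
  have hρν : Continuous fun τ => ρ τ + ν τ := hρ.add hν
  have hcf := continuous_conv hc hf
  have hw : Continuous fun τ => conv f (fun τ => ρ τ + ν τ) τ - ρ τ :=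
    (continuous_conv hf hρν).sub hρ
  rw [eq_expVec_add_conv hw hy i ht,
    conv_sub_right hc (continuous_conv hf hρν) hρ, conv_assoc hc hf hρν ht,
    conv_add_right hcf hρ hν, conv_sub_left hcf hc hρ]
  ring

/-! ### Boundedness and convergence -/

lemma sum_abs_le_thetaMax {n : ℕ} {Ω : Set (Fin n → ℝ)} (hΩ : IsCompact Ω) {z : Fin n → ℝ}
    (hz : z ∈ Ω) : ∑ i, |z i| ≤ thetaMax Ω :=
  le_csSup (hΩ.image (by fun_prop)).bddAbove ⟨z, hz, rfl⟩

lemma abs_dotProduct_le {n : ℕ} (z x : Fin n → ℝ) : |z ⬝ᵥ x| ≤ (∑ i, |z i|) * ‖x‖ := by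
  rw [dotProduct, Finset.sum_mul]
  refine (Finset.abs_sum_le_sum_abs _ _).trans (Finset.sum_le_sum fun i _ => ?_)
  rw [abs_mul]
  exact mul_le_mul_of_nonneg_left (norm_le_pi_norm x i) (abs_nonneg _)

lemma abs_dotProduct_le_thetaMax {n : ℕ} {Ω : Set (Fin n → ℝ)} (hΩ : IsCompact Ω)
    {z : Fin n → ℝ} (hz : z ∈ Ω) (x : Fin n → ℝ) : |z ⬝ᵥ x| ≤ thetaMax Ω * ‖x‖ :=
  (abs_dotProduct_le z x).trans
    (mul_le_mul_of_nonneg_right (sum_abs_le_thetaMax hΩ hz) (norm_nonneg _))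

lemma ofReal_integral_le_l1Gain {n : ℕ} {H : Matrix (Fin n) (Fin 1) (RatFunc ℝ)} {i : Fin n}
    {g : ℝ → ℝ} (hg : IsImpulseResponse g (H i 0)) (hgi : IntegrableOn g (Set.Ioi 0)) :
    ENNReal.ofReal (∫ t in Set.Ioi (0 : ℝ), |g t|) ≤ l1Gain H := by
  rw [ofReal_integral_eq_lintegral_ofReal hgi.abs
    (Filter.Eventually.of_forall fun _ => abs_nonneg _), l1Gain]
  refine le_trans (le_of_eq ?_) (le_iSup _ i)
  rw [Fin.sum_univ_one]
  refine setLIntegral_congr_fun measurableSet_Ioi fun t ht => ?_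
  simp only [impulseResponse_eq hg (le_of_lt ht)]

/-- A signal with bounded derivative that is square integrable tends to zero. -/
lemma tendsto_zero_of_sq_integral_bounded {e e' : ℝ → ℝ}
    (he : ∀ t, 0 ≤ t → HasDerivWithinAt e (e' t) (Set.Ici 0) t)
    (he'c : ContinuousOn e' (Set.Ici 0)) {B D I : ℝ} (hB : ∀ t, 0 ≤ t → |e t| ≤ B)
    (hD : ∀ t, 0 ≤ t → |e' t| ≤ D) (hI : ∀ T, 0 ≤ T → ∫ t in (0 : ℝ)..T, e t ^ 2 ≤ I) :
    Filter.Tendsto e Filter.atTop (nhds 0) := by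
  have hc : ContinuousOn e (Set.Ici 0) := fun t ht => (he t ht).continuousWithinAt
  have hsq : IntegrableOn (fun t => e t ^ 2) (Set.Ioi 0) := by
    refine integrableOn_Ioi_of_intervalIntegral_norm_bounded (l := Filter.atTop) (b := id) I 0
      (fun T => ?_) Filter.tendsto_id ?_
    · exact (((hc.pow 2).mono Set.Icc_subset_Ici_self).integrableOn_Icc).mono_set
        Set.Ioc_subset_Icc_self
    · filter_upwards [Filter.eventually_ge_atTop 0] with T hT
      refine le_trans (le_of_eq ?_) (hI T hT)
      simp
  have hmeas : ∀ {g : ℝ → ℝ}, ContinuousOn g (Set.Ici 0) →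
      AEStronglyMeasurable g (volume.restrict (Set.Ioi 0)) := fun hg =>
    (hg.mono Set.Ioi_subset_Ici_self).aestronglyMeasurable measurableSet_Ioi
  have hbd : ∀ {g : ℝ → ℝ} {M : ℝ}, (∀ t, 0 ≤ t → |g t| ≤ M) →
      ∀ᵐ t ∂(volume.restrict (Set.Ioi 0)), ‖g t‖ ≤ M := fun hg =>
    (ae_restrict_iff' measurableSet_Ioi).2
      (Filter.Eventually.of_forall fun t ht => hg t (le_of_lt ht))
  -- The cube and its derivative `3 e² e'` are both a bounded function times the integrable `e²`, so
  -- the cube tends to zero.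
  have h3 : Filter.Tendsto (fun t => e t ^ 3) Filter.atTop (nhds 0) := by
    refine tendsto_zero_of_hasDerivAt_of_integrableOn_Ioi (a := 0)
      (f' := fun t => 3 * (e' t * e t ^ 2)) (fun t ht => ?_) ?_ ?_
    · have h := ((he t (le_of_lt ht)).hasDerivAt (Ici_mem_nhds ht)).pow 3
      convert! h using 1
      norm_num
      ring
    · exact (Integrable.bdd_mul (c := D) hsq (hmeas he'c) (hbd hD)).const_mul 3
    · have h := Integrable.bdd_mul (c := B) hsq (hmeas hc) (hbd hB)
      exact h.congr (Filter.Eventually.of_forall fun t => (pow_succ' (e t) 2).symm)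
  rw [tendsto_zero_iff_abs_tendsto_zero] at h3 ⊢
  have h4 := h3.rpow_const (p := 1 / 3) (Or.inr (by norm_num))
  rw [Real.zero_rpow (by norm_num)] at h4
  refine h4.congr fun t => ?_
  simp only [Function.comp_apply, abs_pow]
  rw [← Real.rpow_natCast, ← Real.rpow_mul (abs_nonneg _)]
  norm_num

/-- The hypothesis is applied at a maximum point `s` of the norm on `[0, t]`, with `B = ‖y s‖`.
Working on compact intervals avoids assuming a finite global supremum. -/
lemma norm_le_of_small_gain {n : ℕ} {y : ℝ → Fin n → ℝ} (hy : ContinuousOn y (Set.Ici 0))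
    {a q : ℝ} (ha : 0 ≤ a) (hq0 : 0 ≤ q) (hq : q < 1)
    (h : ∀ t, 0 ≤ t → ∀ B, (∀ τ ∈ Set.Icc 0 t, ‖y τ‖ ≤ B) → ∀ i, |y t i| ≤ a + q * B)
    {t : ℝ} (ht : 0 ≤ t) : ‖y t‖ ≤ a / (1 - q) := by
  obtain ⟨s, hs, hmax⟩ := isCompact_Icc.exists_isMaxOn (Set.nonempty_Icc.2 ht)
    (hy.mono Set.Icc_subset_Ici_self).norm
  have hle : ∀ τ ∈ Set.Icc 0 t, ‖y τ‖ ≤ ‖y s‖ := fun τ hτ => hmax hτ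
  have h1 := h s hs.1 ‖y s‖ fun τ hτ => hle τ ⟨hτ.1, hτ.2.trans hs.2⟩
  have h2 : ‖y s‖ ≤ a + q * ‖y s‖ := (pi_norm_le_iff_of_nonneg (by positivity)).2 h1
  have h3 : ‖y s‖ ≤ a / (1 - q) := by
    rw [le_div_iff₀ (by linarith)]
    linarith
  exact (hle t ⟨ht, le_rfl⟩).trans h3

/-- Freezing a signal at its initial value for negative times makes it continuous on the line
without affecting convolutions on `[0, t]`. -/
lemma continuous_comp_max {v : ℝ → ℝ} (hv : ContinuousOn v (Set.Ici 0)) :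
    Continuous fun t => v (max t 0) :=
  hv.comp_continuous (by fun_prop) fun t => le_max_right t 0

/-- The prediction error `e = x̂ - x` has derivative `A_m e - b (θ̂ - θ)ᵀ x`. -/
lemma IsTrajectory.hasDerivWithinAt_error {n : ℕ} {A : Matrix (Fin n) (Fin n) ℝ}
    {b c K : Fin n → ℝ} {C : RatFunc ℝ} {P : Matrix (Fin n) (Fin n) ℝ} {Γc : ℝ}
    {Ω : Set (Fin n → ℝ)} {θ : Fin n → ℝ} {r : ℝ → ℝ} {x₀ θhat₀ : Fin n → ℝ}
    {x xhat θhat : ℝ → Fin n → ℝ} {u u₁ u₂ : ℝ → ℝ}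
    (h : IsTrajectory A b c K C P Γc Ω θ r x₀ θhat₀ x xhat θhat u u₁ u₂) {t : ℝ} (ht : 0 ≤ t) :
    HasDerivWithinAt (fun t => xhat t - x t)
      ((closedMatrix A b K).mulVec (xhat t - x t) - ((θhat t - θ) ⬝ᵥ x t) • b)
      (Set.Ici 0) t := by
  refine ((h.xhat_deriv t ht).sub (h.x_deriv t ht)).congr_deriv ?_
  have hv : (Matrix.vecMulVec b K).mulVec (x t) = (K ⬝ᵥ x t) • b := by
    ext i
    simp only [Matrix.mulVec, dotProduct, Matrix.vecMulVec_apply, Pi.smul_apply, smul_eq_mul,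
      Finset.sum_mul]
    exact Finset.sum_congr rfl fun j _ => by ring
  have hAx : A.mulVec (x t) = (closedMatrix A b K).mulVec (x t) + (K ⬝ᵥ x t) • b := by
    rw [closedMatrix, Matrix.sub_mulVec, hv, sub_add_cancel]
  rw [h.control t ht, h.control_one t ht, hAx, Matrix.mulVec_sub, sub_dotProduct]
  module

end L1Adaptive

end

/-! ### The main theorem -/

open L1Adaptive in
theorem theorem1 {n : ℕ}
    (A : Matrix (Fin n) (Fin n) ℝ) (b c : Fin n → ℝ)
    (hAb : L1Adaptive.IsControllable A b)
    (Ω : Set (Fin n → ℝ)) (hΩ_compact : IsCompact Ω) (hΩ_convex : Convex ℝ Ω)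
    (θ : Fin n → ℝ) (hθ : θ ∈ Ω)
    (r : ℝ → ℝ) (hr_cont : ContinuousOn r (Set.Ici 0))
    (hr_bdd : ∃ R : ℝ, ∀ t, 0 ≤ t → |r t| ≤ R)
    (K : Fin n → ℝ) (hK : L1Adaptive.IsHurwitz (L1Adaptive.closedMatrix A b K))
    (hdc : L1Adaptive.dcGain (L1Adaptive.closedMatrix A b K) b c ≠ 0)
    (C : RatFunc ℝ) (hC_stable : L1Adaptive.IsStable C)
    (hC_proper : L1Adaptive.IsStrictlyProper C)
    (hC_zero : C.eval (RingHom.id ℝ) 0 = 1)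
    (P Q : Matrix (Fin n) (Fin n) ℝ) (hQ : Q.PosDef)
    (hP : (L1Adaptive.closedMatrix A b K).transpose * P
      + P * L1Adaptive.closedMatrix A b K = -Q)
    (Γc : ℝ) (hΓ : 0 < Γc)
    (hgain : L1Adaptive.l1Gain (L1Adaptive.Gbar (L1Adaptive.closedMatrix A b K) b C)
      * ENNReal.ofReal (L1Adaptive.thetaMax Ω) < 1)
    (x₀ θhat₀ : Fin n → ℝ) (hθhat₀ : θhat₀ ∈ Ω)
    (x xhat θhat : ℝ → Fin n → ℝ) (u u₁ u₂ : ℝ → ℝ)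
    (htraj : L1Adaptive.IsTrajectory A b c K C P Γc Ω θ r x₀ θhat₀ x xhat θhat u u₁ u₂) :
    (∃ M : ℝ, ∀ t, 0 ≤ t → ‖xhat t‖ ≤ M) ∧
    (∃ M : ℝ, ∀ t, 0 ≤ t → ‖x t‖ ≤ M) ∧
    Filter.Tendsto (fun t => xhat t - x t) Filter.atTop (nhds 0) := by
  set Am := closedMatrix A b K with hAm
  obtain ⟨v, hv, hproj, hlaw⟩ := htraj.θhat_law
  obtain ⟨R, hR⟩ := hr_bdd
  have hxc : ContinuousOn x (Set.Ici 0) := fun t ht => (htraj.x_deriv t ht).continuousWithinAt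
  have hyc : ContinuousOn xhat (Set.Ici 0) :=
    fun t ht => (htraj.xhat_deriv t ht).continuousWithinAt
  have hθc : ContinuousOn θhat (Set.Ici 0) :=
    ((continuousOn_integral_Ici hv).const_smul Γc |>.const_add θhat₀).congr hlaw
  have hθΩ : ∀ t, 0 ≤ t → θhat t ∈ Ω := fun t ht =>
    mem_of_velocity_mem_tangentCone hΩ_compact.isClosed hΩ_convex hΓ hθhat₀ hv
      (hproj.mono fun _ h => h.1) hlaw ht
  have hθmax : 0 ≤ thetaMax Ω :=
    (Finset.sum_nonneg fun i _ => abs_nonneg (θ i)).trans (sum_abs_le_thetaMax hΩ_compact hθ)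
  -- the prediction error
  set e : ℝ → Fin n → ℝ := fun t => xhat t - x t with he_def
  have hec : ContinuousOn e (Set.Ici 0) := hyc.sub hxc
  have he0 : e 0 = 0 := by simp [he_def, htraj.x_zero, htraj.xhat_zero]
  have hed : ∀ t, 0 ≤ t → HasDerivWithinAt e
      (Am.mulVec (e t) - ((θhat t - θ) ⬝ᵥ x t) • b) (Set.Ici 0) t :=
    fun t ht => htraj.hasDerivWithinAt_error ht
  have hQs : Q.transpose = Q := by simpa using hQ.isHermitian.eq
  have hQpos : ∀ y : Fin n → ℝ, y ≠ 0 → 0 < y ⬝ᵥ Q.mulVec y := fun y hy => by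
    simpa using hQ.dotProduct_mulVec_pos hy
  obtain ⟨m, hm, hmP⟩ := exists_coercive (dotProduct_mulVec_pos_of_lyapunov hK hQpos hP)
  obtain ⟨k, hk, hkQ⟩ := exists_coercive hQpos
  set V := ∑ i, (θhat₀ i - θ i) ^ 2 with hV
  have hQnn : ∀ y : Fin n → ℝ, 0 ≤ y ⬝ᵥ Q.mulVec y := fun y =>
    le_trans (by positivity) (hkQ y)
  have hPnn : ∀ y : Fin n → ℝ, 0 ≤ y ⬝ᵥ P.mulVec y := fun y =>
    le_trans (by positivity) (hmP y)
  have hlyap : ∀ T, 0 ≤ T → Γc * (e T ⬝ᵥ P.mulVec (e T))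
      + Γc * (∫ t in (0 : ℝ)..T, e t ⬝ᵥ Q.mulVec (e t)) ≤ V := fun T hT =>
    lyapunov_estimate (transpose_eq_of_lyapunov hK hQs hP) hP hΩ_convex hθ hΓ hxc he0 hed hv
      hproj hlaw hT
  have hV0 : 0 ≤ V := Finset.sum_nonneg fun i _ => sq_nonneg _
  -- From `Γc m ‖e‖² ≤ Γc eᵀPe ≤ V`; this bound does not depend on the size of `x`.
  set E := Real.sqrt (V / (Γc * m)) with hE
  have heE : ∀ t, 0 ≤ t → ‖e t‖ ≤ E := by
    intro t ht
    refine Real.le_sqrt_of_sq_le ?_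
    rw [le_div_iff₀ (by positivity)]
    have h1 : 0 ≤ ∫ t in (0 : ℝ)..t, e t ⬝ᵥ Q.mulVec (e t) :=
      intervalIntegral.integral_nonneg ht fun τ _ => hQnn _
    have h2 := mul_le_mul_of_nonneg_left (hmP (e t)) hΓ.le
    have h3 := mul_nonneg hΓ.le h1
    linarith [hlyap t ht]
  have hE0 : 0 ≤ E := Real.sqrt_nonneg _
  -- the predictor as a response
  obtain ⟨f, hfc, hfi, hfl⟩ := exists_impulseResponse hC_stable hC_proper
  have hfC := isImpulseResponse_of_laplace hfc hfi hfl
  set kg := 1 / dcGain Am b c with hkg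
  have hrbar : ContinuousOn (fun t => θhat t ⬝ᵥ x t) (Set.Ici 0) := by
    have h1 := continuousOn_pi.1 hxc
    have h2 := continuousOn_pi.1 hθc
    simp only [dotProduct]
    fun_prop
  set ρ : ℝ → ℝ := fun t => θhat (max t 0) ⬝ᵥ x (max t 0) with hρ
  set ν : ℝ → ℝ := fun t => kg * r (max t 0) with hν
  have hρc : Continuous ρ := continuous_comp_max hrbar
  have hνc : Continuous ν := (continuous_comp_max hr_cont).const_mul kg
  have hu₂ : ∀ t, 0 ≤ t → u₂ t = conv f (fun τ => ρ τ + ν τ) t := by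
    intro t ht
    rw [htraj.control_two t ht]
    refine conv_congr_on (fun τ hτ => impulseResponse_eq hfC hτ) (fun τ hτ => ?_) ht
    simp only [hρ, hν, max_eq_left hτ]
    rfl
  have hyd : ∀ t, 0 ≤ t → HasDerivWithinAt xhat
      (Am.mulVec (xhat t) + (conv f (fun τ => ρ τ + ν τ) t - ρ t) • b) (Set.Ici 0) t := by
    intro t ht
    refine (htraj.xhat_deriv t ht).congr_deriv ?_
    rw [← hu₂ t ht, show ρ t = θhat t ⬝ᵥ x t by simp only [hρ, max_eq_left ht]]
    module
  have hyeq := fun (i : Fin n) (t : ℝ) (ht : 0 ≤ t) => predictor_eq hfc hρc hνc hyd i ht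
  set g : Fin n → ℝ → ℝ := fun i t => conv (fun t => expVec Am b t i) f t - expVec Am b t i
    with hg
  have hhi := fun i : Fin n => integrableOn_expVec_apply hK b i
  have hhc := fun i : Fin n => continuous_expVec_apply Am b i
  have hgc : ∀ i, Continuous (g i) := fun i => (continuous_conv (hhc i) hfc).sub (hhc i)
  have hgi : ∀ i, IntegrableOn (g i) (Set.Ioi 0) :=
    fun i => (integrableOn_conv (hhi i) hfi).sub (hhi i)
  -- The product is finite by the gain condition, so `toReal` loses nothing and no separate bound on
  -- the gain is needed.
  set q := (l1Gain (Gbar Am b C) * ENNReal.ofReal (thetaMax Ω)).toReal with hq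
  have hq1 : q < 1 := by
    have := (ENNReal.toReal_lt_toReal hgain.ne_top ENNReal.one_ne_top).2 hgain
    rwa [ENNReal.toReal_one] at this
  have hq0 : 0 ≤ q := ENNReal.toReal_nonneg
  have hgq : ∀ i, (∫ t in Set.Ioi (0 : ℝ), |g i t|) * thetaMax Ω ≤ q := by
    intro i
    rw [hq, ← ENNReal.ofReal_le_iff_le_toReal hgain.ne_top, ENNReal.ofReal_mul' hθmax]
    gcongr
    exact ofReal_integral_le_l1Gain
      (isImpulseResponse_Gbar hK b hC_stable hfc hfi hfl i) (hgi i)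
  choose N hN using fun i : Fin n => exists_bound_expVec_apply hK (xhat 0) i
  -- `L i` bounds the free response and the response to the reference. These are summed over `i`
  -- below to give one constant for all components.
  set L : Fin n → ℝ := fun i => |N i|
    + (∫ t in Set.Ioi (0 : ℝ), |conv (fun t => expVec Am b t i) f t|) * (|kg| * |R|) with hL
  have hL0 : ∀ i, 0 ≤ L i := fun i => add_nonneg (abs_nonneg _)
    (mul_nonneg (integral_nonneg fun _ => abs_nonneg _) (by positivity))
  have hbound : ∀ t, 0 ≤ t → ∀ B, (∀ τ ∈ Set.Icc 0 t, ‖xhat τ‖ ≤ B) → ∀ i,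
      |xhat t i| ≤ (∑ i, L i + q * E) + q * B := by
    intro t ht B hB i
    have hB0 : 0 ≤ B := (norm_nonneg _).trans (hB 0 ⟨le_rfl, ht⟩)
    have h1 : |expVec Am (xhat 0) t i| ≤ |N i| := (hN i t ht).trans (le_abs_self _)
    have h2 : |conv (g i) ρ t| ≤ (∫ t in Set.Ioi (0 : ℝ), |g i t|) * (thetaMax Ω * (B + E)) := by
      refine abs_conv_le (hgc i) (hgi i) ht fun τ hτ => ?_
      simp only [hρ, max_eq_left hτ.1]
      refine (abs_dotProduct_le_thetaMax hΩ_compact (hθΩ τ hτ.1) _).trans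
        (mul_le_mul_of_nonneg_left ?_ hθmax)
      have : x τ = xhat τ - e τ := by simp [he_def]
      rw [this]
      exact (norm_sub_le _ _).trans (add_le_add (hB τ hτ) (heE τ hτ.1))
    have h3 : |conv (conv (fun t => expVec Am b t i) f) ν t|
        ≤ (∫ t in Set.Ioi (0 : ℝ), |conv (fun t => expVec Am b t i) f t|) * (|kg| * |R|) := by
      refine abs_conv_le (continuous_conv (hhc i) hfc) (integrableOn_conv (hhi i) hfi) ht
        fun τ hτ => ?_
      simp only [hν, max_eq_left hτ.1, abs_mul]
      exact mul_le_mul_of_nonneg_left ((hR τ hτ.1).trans (le_abs_self _)) (abs_nonneg _)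
    have h4 : (∫ t in Set.Ioi (0 : ℝ), |g i t|) * (thetaMax Ω * (B + E)) ≤ q * (B + E) := by
      rw [← mul_assoc]
      exact mul_le_mul_of_nonneg_right (hgq i) (by linarith)
    have h5 : L i ≤ ∑ i, L i := Finset.single_le_sum (fun i _ => hL0 i) (Finset.mem_univ i)
    rw [hyeq i t ht]
    refine (abs_add_three _ _ _).trans ?_
    simp only [hL] at h5 ⊢
    linarith
  have ha0 : 0 ≤ ∑ i, L i + q * E :=
    add_nonneg (Finset.sum_nonneg fun i _ => hL0 i) (mul_nonneg hq0 hE0)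
  set M := (∑ i, L i + q * E) / (1 - q) with hM
  have hyM : ∀ t, 0 ≤ t → ‖xhat t‖ ≤ M := fun t ht =>
    norm_le_of_small_gain hyc ha0 hq0 hq1 hbound ht
  have hxM : ∀ t, 0 ≤ t → ‖x t‖ ≤ M + E := fun t ht => by
    have : x t = xhat t - e t := by simp [he_def]
    rw [this]
    exact (norm_sub_le _ _).trans (add_le_add (hyM t ht) (heE t ht))
  refine ⟨⟨M, hyM⟩, ⟨M + E, hxM⟩, ?_⟩
  -- convergence of the prediction error
  rw [tendsto_pi_nhds]
  intro i
  have hei := continuousOn_pi.1 hec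
  -- `D` bounds `ė`: a row sum of `A_m` times `E`, plus one `θ_max` term each for `θ̂` and `θ`. `I`
  -- comes from the Lyapunov estimate and `k ‖e‖² ≤ eᵀQe`.
  refine tendsto_zero_of_sq_integral_bounded (e := fun t => e t i) (B := E)
    (D := (∑ j, |Am i j|) * E + (thetaMax Ω * (M + E) + thetaMax Ω * (M + E)) * |b i|)
    (I := V / (Γc * k))
    (fun t ht => hasDerivWithinAt_pi.1 (hed t ht) i) ?_
    (fun t ht => (norm_le_pi_norm (e t) i).trans (heE t ht)) ?_ ?_
  · have h1 := continuousOn_pi.1 hxc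
    have h2 := continuousOn_pi.1 hθc
    simp only [Pi.sub_apply, Pi.smul_apply, Matrix.mulVec, dotProduct, smul_eq_mul]
    fun_prop
  · intro t ht
    have h1 : |Am.mulVec (e t) i| ≤ (∑ j, |Am i j|) * E :=
      (abs_dotProduct_le (Am i) (e t)).trans (mul_le_mul_of_nonneg_left (heE t ht)
        (Finset.sum_nonneg fun _ _ => abs_nonneg _))
    have h2 : ∀ z ∈ Ω, |z ⬝ᵥ x t| ≤ thetaMax Ω * (M + E) := fun z hz =>
      (abs_dotProduct_le_thetaMax hΩ_compact hz _).trans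
        (mul_le_mul_of_nonneg_left (hxM t ht) hθmax)
    simp only [Pi.sub_apply, Pi.smul_apply, smul_eq_mul]
    refine (abs_sub _ _).trans (add_le_add h1 ?_)
    rw [abs_mul, sub_dotProduct]
    exact mul_le_mul_of_nonneg_right ((abs_sub _ _).trans
      (add_le_add (h2 _ (hθΩ t ht)) (h2 _ hθ))) (abs_nonneg _)
  · intro T hT
    have hsub : Set.uIcc 0 T ⊆ Set.Ici 0 := by
      rw [Set.uIcc_of_le hT]
      exact Set.Icc_subset_Ici_self
    have hQc : ContinuousOn (fun t => e t ⬝ᵥ Q.mulVec (e t)) (Set.Ici 0) := by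
      simp only [Matrix.mulVec, dotProduct]
      fun_prop
    have h1 : ∫ t in (0 : ℝ)..T, k * e t i ^ 2 ≤ ∫ t in (0 : ℝ)..T, e t ⬝ᵥ Q.mulVec (e t) := by
      refine intervalIntegral.integral_mono_on hT ?_
        ((hQc.mono hsub).intervalIntegrable) fun t ht => ?_
      · exact ((continuousOn_const.mul ((hei i).pow 2)).mono hsub).intervalIntegrable
      · refine le_trans (mul_le_mul_of_nonneg_left ?_ hk.le) (hkQ (e t))
        rw [← sq_abs]
        exact pow_le_pow_left₀ (abs_nonneg _) (norm_le_pi_norm (e t) i) 2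
    rw [intervalIntegral.integral_const_mul] at h1
    have h2 := mul_nonneg hΓ.le (hPnn (e T))
    have h3 := mul_le_mul_of_nonneg_left h1 hΓ.le
    rw [le_div_iff₀ (by positivity)]
    linarith [hlyap T hT]
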